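/- Let $\mathbb{H}$ be a real Hilbert space and let $A_0$ be a positive-definite self-adjoint operator in $\mathbb{H}$ with compact resolvent, with eigenvalues $0<\lambda_1\le\lambda_2\le\dots$ (counted with multiplicities) and an associated orthonormal basis of eigenvectors $e_1,e_2,\dots$ of $\mathbb{H}$, $A_0e_j=\lambda_je_j$. Let $k,N$ be positive integers and let $\Lambda,\delta>0$ be reals. Put $\alpha=(\lambda_N+\lambda_{N+1})/2$, $\overline\mu=(\lambda_{N+1}-\lambda_N)/2$, $A=-A_0+\alpha I$, and let $$\mathcal P v=\sum_{j:\ \lambda_j<\lambda_N-k}\langle v,e_j\rangle e_j,\qquad \mathcal Q v=\sum_{j:\ \lambda_j>\lambda_{N+1}+k}\langle v,e_j\rangle e_j,\qquad \mathcal I=\mathrm{Id}-\mathcal P-\mathcal Q .$$ Let $\vartheta$ be a semiflow on a complete metric space $X$ and let $a\colon X\to\mathbb{R}$ be continuous with $\sup_{q}|a(q)|\le\Lambda+\delta$. Assume $$\frac{\overline\mu}{\sqrt5}-\delta\ge0\qquad\text{and}\qquad k^2-2\Lambda k-4\frac{\Lambda^4}{\overline\mu^2}\ge0 .$$ Let $\tau_1=\tau_3=1$,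 $\tau_2=\frac14(\overline\mu/\Lambda)^2$, $\mathbb{U}=\mathbb{H}\times\mathbb{H}\ni\xi=(\xi_I,\xi_c)$, $B\xi=\xi_I+\xi_c$, and $$F_1(q)=\tau_1(a(q)^2-\delta^2)\mathcal I-\tau_2\Lambda^2\mathcal I-\tau_3\Lambda^2(\mathcal P+\mathcal Q),\quad F_2(q)v=(-\tau_1a(q)\mathcal Iv,0),\quad F_3\xi=(\tau_1\mathcal I\xi_I+\tau_2(\mathcal P+\mathcal Q)\xi_I,\ \tau_3\xi_c).$$ With $\widehat A(q)=A-a(q)I-BF_3^{-1}F_2(q)$, consider the Hamiltonian system in $\mathbb{H}\times\mathbb{H}$ $$\dot v=\widehat A(\vartheta^t(q))v+BF_3^{-1}B^*\eta,\qquad \dot\eta=\bigl[F_1-F_2^*F_3^{-1}F_2\bigr](\vartheta^t(q))\,v-\widehat A(\vartheta^t(q))^*\eta .$$ Its solutions are understood in the mild sense: writing the system as $\dot v=Av+f$, $\dot\eta=-A\eta+g$, where $f,g$ collect the bounded terms, and with $G$ the $C_0$-semigroup generated by $A$, a solution on $[0,\infty)$ is a continuous $z=(v,\eta)$ with $v(t)=G(t)v(0)+\int_0^tG(t-s)f(s)\,ds$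 for $t\ge0$ and $\eta(t)=G(T-t)\eta(T)-\int_t^TG(s-t)g(s)\,ds$ for $0\le t\le T$. For $q\in X$ let $\mathbb{L}^+_b(q)$ be the subspace of all $z_0\in\mathbb{H}\times\mathbb{H}$ for which there is a bounded solution $z$ on $[0,\infty)$ with $z(0)=z_0$, and let $\mathbb{L}_\eta=\{0\}\times\mathbb{H}$. Then for every $q\in X$: 1) $\dim(\mathbb{L}^+_b(q)\cap\mathbb{L}_\eta)\le N$; 2) $\mathbb{L}^+_b(q)+\mathbb{L}_\eta$ is closed and has finite codimension $\le N$. In particular, $(\mathbb{L}^+_b(q),\mathbb{L}_\eta)$ is a Fredholm pair, that is, a pair of closed subspaces with finite-dimensional intersection whose sum is closed and of finite codimension. -/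

import Mathlib

open Set Filter Topology MeasureTheory
open scoped NNReal InnerProductSpace

namespace SpatialAveraging

noncomputable section

/-! ## Unbounded operators and semigroups -/

section Semigroups

variable {H : Type*} [NormedAddCommGroup H] [InnerProductSpace ℝ H]

/-- `A₀` has a compact resolvent: for some real `ζ` the operator `ζ I - A₀` has a bounded two-sided
inverse, and this inverse is compact. -/
def HasCompactResolvent (A₀ : H →ₗ.[ℝ] H) : Prop :=
  ∃ (ζ : ℝ) (R : H →L[ℝ] H), IsCompactOperator R ∧
    (∀ x : H, ∃ hx : R x ∈ A₀.domain, ζ • R x - A₀ ⟨R x, hx⟩ = x) ∧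
    (∀ x : A₀.domain, R (ζ • (x : H) - A₀ x) = x)

/-- `e` is an orthonormal basis of eigenvectors of `A₀`, with the eigenvalues `lam` listed in
nondecreasing order (and so with their multiplicities). -/
structure IsOrderedEigenbasis (A₀ : H →ₗ.[ℝ] H) (lam : ℕ+ → ℝ) (e : HilbertBasis ℕ+ ℝ H) :
    Prop where
  monotone : Monotone lam
  eigen : ∀ j, ∃ hj : e j ∈ A₀.domain, A₀ ⟨e j, hj⟩ = lam j • e j

/-- The operator `-A₀ + α I`, with the domain of `A₀`. -/
def shiftedNeg (A₀ : H →ₗ.[ℝ] H) (α : ℝ) : H →ₗ.[ℝ] H where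
  domain := A₀.domain
  toFun := -A₀.toFun + α • A₀.domain.subtype

/-- `G` is a strongly continuous semigroup of bounded operators. Only the values `G t` for `t ≥ 0`
matter. -/
structure IsC0Semigroup (G : ℝ → H →L[ℝ] H) : Prop where
  zero : G 0 = ContinuousLinearMap.id ℝ H
  add : ∀ s t : ℝ, 0 ≤ s → 0 ≤ t → G (s + t) = (G s).comp (G t)
  continuousOn : ∀ x : H, ContinuousOn (fun t => G t x) (Ici 0)

/-- `A` is the infinitesimal generator of `G`: `(x, y)` is in the graph of `A` iff
`t⁻¹ (G t x - x) → y` as `t → 0+`. -/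
def IsGenerator (G : ℝ → H →L[ℝ] H) (A : H →ₗ.[ℝ] H) : Prop :=
  ∀ x y : H, (x, y) ∈ A.graph ↔ Tendsto (fun t : ℝ => t⁻¹ • (G t x - x)) (𝓝[>] 0) (𝓝 y)

open Classical in
/-- The `C₀`-semigroup generated by `A` (unique on `t ≥ 0` when it exists; `0` by convention if `A`
is not the generator of a `C₀`-semigroup). -/
def generatedSemigroup (A : H →ₗ.[ℝ] H) : ℝ → H →L[ℝ] H :=
  if h : ∃ G : ℝ → H →L[ℝ] H, IsC0Semigroup G ∧ IsGenerator G A then h.choose else 0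

/-- `v` is a mild solution on `[0, ∞)` of `v' = A v + f`, where `A` generates the semigroup `G`
(Cauchy formula; this equation is solved forwards in time). -/
def IsForwardMild (G : ℝ → H →L[ℝ] H) (v f : ℝ → H) : Prop :=
  ∀ t : ℝ, 0 ≤ t →
    IntervalIntegrable (fun s => G (t - s) (f s)) volume 0 t ∧
    v t = G t (v 0) + ∫ s in (0 : ℝ)..t, G (t - s) (f s)

/-- `η` is a mild solution on `[0, ∞)` of `η' = -A η + g`, where `A` generates the semigroup `G`.
This equation is solved backwards in time: on each `[0, T]` the function `τ ↦ η (T - τ)` is a mild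
solution of `w' = A w - g (T - ·)`. -/
def IsBackwardMild (G : ℝ → H →L[ℝ] H) (η g : ℝ → H) : Prop :=
  ∀ t T : ℝ, 0 ≤ t → t ≤ T →
    IntervalIntegrable (fun s => G (s - t) (g s)) volume t T ∧
    η t = G (T - t) (η T) - ∫ s in t..T, G (s - t) (g s)

end Semigroups

/-! ## Subspaces of `H × H` -/

/-- The Hilbert space `H × H` (with the Hilbert norm). -/
abbrev Dbl (H : Type*) : Type _ := WithLp 2 (H × H)

section Double

variable {H : Type*} [NormedAddCommGroup H] [InnerProductSpace ℝ H]

/-- The vertical subspace `{0} × H`. -/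
def vertical (H : Type*) [NormedAddCommGroup H] [InnerProductSpace ℝ H] :
    Submodule ℝ (Dbl H) where
  carrier := {z | z.fst = 0}
  zero_mem' := by simp
  add_mem' := by
    intro x y hx hy
    simp only [mem_ofPred_eq] at hx hy ⊢
    simp [hx, hy]
  smul_mem' := by
    intro c x hx
    simp only [mem_ofPred_eq] at hx ⊢
    simp [hx]

/-- A Fredholm pair of closed subspaces: the intersection is finite-dimensional, and the sum is
closed and of finite codimension. -/
structure IsFredholmPair {E : Type*} [NormedAddCommGroup E] [NormedSpace ℝ E]
    (L M : Submodule ℝ E) : Prop where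
  isClosed_left : IsClosed (L : Set E)
  isClosed_right : IsClosed (M : Set E)
  finiteDimensional_inf : FiniteDimensional ℝ ↥(L ⊓ M)
  isClosed_sup : IsClosed ((L ⊔ M : Submodule ℝ E) : Set E)
  finiteDimensional_quotient : FiniteDimensional ℝ (E ⧸ (L ⊔ M))

/-- The operator `x ↦ (f x, g x)` into `H × H`. -/
def pairL {E : Type*} [NormedAddCommGroup E] [InnerProductSpace ℝ E] (f g : E →L[ℝ] H) :
    E →L[ℝ] Dbl H :=
  ((WithLp.prodContinuousLinearEquiv 2 ℝ H H).symm : (H × H) →L[ℝ] Dbl H).comp (f.prod g)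

/-- The first coordinate `H × H → H`. -/
def fstD (H : Type*) [NormedAddCommGroup H] [InnerProductSpace ℝ H] : Dbl H →L[ℝ] H :=
  WithLp.fstL 2 ℝ H H

/-- The second coordinate `H × H → H`. -/
def sndD (H : Type*) [NormedAddCommGroup H] [InnerProductSpace ℝ H] : Dbl H →L[ℝ] H :=
  WithLp.sndL 2 ℝ H H

end Double

section Solutions

variable {H : Type*} [NormedAddCommGroup H] [InnerProductSpace ℝ H]

/-! ## Solutions of Hamiltonian systems -/

/-- `z = (v, η)` is a (mild) solution on `[0, ∞)` of
`v' = A v + (R(t) z)_1`, `η' = -A η + (R(t) z)_2`, where `G` is the semigroup generated by `A`. -/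
def IsSolution (G : ℝ → H →L[ℝ] H) (R : ℝ → Dbl H →L[ℝ] Dbl H) (z : ℝ → Dbl H) : Prop :=
  ContinuousOn z (Ici 0) ∧
    IsForwardMild G (fun t => (z t).fst) (fun t => (R t (z t)).fst) ∧
    IsBackwardMild G (fun t => (z t).snd) (fun t => (R t (z t)).snd)

theorem IsSolution.zero (G : ℝ → H →L[ℝ] H) (R : ℝ → Dbl H →L[ℝ] Dbl H) :
    IsSolution G R (fun _ => 0) := by
  refine ⟨continuousOn_const, ?_, ?_⟩
  · intro t _
    simp
  · intro t T _ _
    simp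

theorem IsSolution.add {G : ℝ → H →L[ℝ] H} {R : ℝ → Dbl H →L[ℝ] Dbl H} {z w : ℝ → Dbl H}
    (hz : IsSolution G R z) (hw : IsSolution G R w) :
    IsSolution G R (fun t => z t + w t) := by
  refine ⟨hz.1.add hw.1, ?_, ?_⟩
  · intro t ht
    obtain ⟨h1, h2⟩ := hz.2.1 t ht
    obtain ⟨h3, h4⟩ := hw.2.1 t ht
    beta_reduce at h1 h2 h3 h4
    simp only [map_add, WithLp.add_fst]
    refine ⟨h1.add h3, ?_⟩
    rw [intervalIntegral.integral_add h1 h3, h2, h4]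
    abel
  · intro t T ht hT
    obtain ⟨h1, h2⟩ := hz.2.2 t T ht hT
    obtain ⟨h3, h4⟩ := hw.2.2 t T ht hT
    beta_reduce at h1 h2 h3 h4
    simp only [map_add, WithLp.add_snd]
    refine ⟨h1.add h3, ?_⟩
    rw [intervalIntegral.integral_add h1 h3, h2, h4]
    abel

theorem IsSolution.smul {G : ℝ → H →L[ℝ] H} {R : ℝ → Dbl H →L[ℝ] Dbl H} {z : ℝ → Dbl H}
    (c : ℝ) (hz : IsSolution G R z) : IsSolution G R (fun t => c • z t) := by
  refine ⟨hz.1.const_smul c, ?_, ?_⟩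
  · intro t ht
    obtain ⟨h1, h2⟩ := hz.2.1 t ht
    beta_reduce at h1 h2
    simp only [map_smul, WithLp.smul_fst]
    refine ⟨h1.smul c, ?_⟩
    rw [intervalIntegral.integral_smul, h2, smul_add]
  · intro t T ht hT
    obtain ⟨h1, h2⟩ := hz.2.2 t T ht hT
    beta_reduce at h1 h2
    simp only [map_smul, WithLp.smul_snd]
    refine ⟨h1.smul c, ?_⟩
    rw [intervalIntegral.integral_smul, h2, smul_sub]

/-- The subspace of all `z₀` such that there is a bounded solution on `[0, ∞)` starting at `z₀`. -/
def boundedSubspace (G : ℝ → H →L[ℝ] H) (R : ℝ → Dbl H →L[ℝ] Dbl H) : Submodule ℝ (Dbl H) where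
  carrier := {z₀ | ∃ z : ℝ → Dbl H, IsSolution G R z ∧ z 0 = z₀ ∧ ∃ K : ℝ, ∀ t, 0 ≤ t → ‖z t‖ ≤ K}
  zero_mem' := ⟨fun _ => 0, IsSolution.zero G R, rfl, 0, fun t _ => by simp⟩
  add_mem' := by
    rintro x y ⟨z, hz, hz0, K, hK⟩ ⟨w, hw, hw0, M, hM⟩
    refine ⟨fun t => z t + w t, hz.add hw, by simp [hz0, hw0], K + M, fun t ht => ?_⟩
    exact (norm_add_le _ _).trans (add_le_add (hK t ht) (hM t ht))
  smul_mem' := by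
    rintro c x ⟨z, hz, hz0, K, hK⟩
    refine ⟨fun t => c • z t, hz.smul c, by simp [hz0], ‖c‖ * K, fun t ht => ?_⟩
    rw [norm_smul]
    exact mul_le_mul_of_nonneg_left (hK t ht) (norm_nonneg c)

end Solutions

section System

variable {H : Type*} [NormedAddCommGroup H] [InnerProductSpace ℝ H] [CompleteSpace H]

/-! ## Spectral projectors -/

/-- The orthogonal projector onto the closed linear span of the `e j`, `j ∈ S`. -/
def spectralProj (e : HilbertBasis ℕ+ ℝ H) (S : Set ℕ+) : H →L[ℝ] H :=
  ((Submodule.span ℝ (e '' S)).topologicalClosure).starProjection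

/-- The projector on the essentially lower modes, `λ_j < λ_N - k`. -/
def lowerProj (e : HilbertBasis ℕ+ ℝ H) (lam : ℕ+ → ℝ) (k N : ℕ+) : H →L[ℝ] H :=
  spectralProj e {j | lam j < lam N - ((k : ℕ) : ℝ)}

/-- The projector on the essentially higher modes, `λ_j > λ_{N+1} + k`. -/
def higherProj (e : HilbertBasis ℕ+ ℝ H) (lam : ℕ+ → ℝ) (k N : ℕ+) : H →L[ℝ] H :=
  spectralProj e {j | lam j > lam (N + 1) + ((k : ℕ) : ℝ)}

/-- The sum of the projectors on the essentially lower and on the essentially higher modes. -/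
def outerProj (e : HilbertBasis ℕ+ ℝ H) (lam : ℕ+ → ℝ) (k N : ℕ+) : H →L[ℝ] H :=
  lowerProj e lam k N + higherProj e lam k N

/-- The projector on the intermediate modes. -/
def interProj (e : HilbertBasis ℕ+ ℝ H) (lam : ℕ+ → ℝ) (k N : ℕ+) : H →L[ℝ] H :=
  ContinuousLinearMap.id ℝ H - lowerProj e lam k N - higherProj e lam k N

/-! ## The quadratic forms and the Hamiltonian

Here `I` and `C` stand for the projectors on the intermediate modes and on the others, `U = H × H`
is the control space, and the quadratic form is
`⟪F₁ v, v⟫ + 2 ⟪F₂ v, ξ⟫ + ⟪F₃ ξ, ξ⟫`, i.e. for `ξ = (ξ_I, ξ_c)` it equals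
`τ₁ (|I ξ_I - a I v|² - δ² |I v|²) + τ₂ (|C ξ_I|² - Λ² |I v|²) + τ₃ (|ξ_c|² - Λ² |C v|²)`. -/

/-- The coefficient `F₁` of the quadratic form, for the value `a` of the scalar function. -/
def opF1 (I C : H →L[ℝ] H) (τ₁ τ₂ τ₃ Λ δ a : ℝ) : H →L[ℝ] H :=
  (τ₁ * a ^ 2) • I - (τ₁ * δ ^ 2) • I - (τ₂ * Λ ^ 2) • I - (τ₃ * Λ ^ 2) • C

/-- The coefficient `F₂ v = (-τ₁ a I v, 0)`. -/
def opF2 (I : H →L[ℝ] H) (τ₁ a : ℝ) : H →L[ℝ] Dbl H :=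
  pairL ((-(τ₁ * a)) • I) 0

/-- The coefficient `F₃ ξ = (τ₁ I ξ_I + τ₂ C ξ_I, τ₃ ξ_c)`. -/
def opF3 (I C : H →L[ℝ] H) (τ₁ τ₂ τ₃ : ℝ) : Dbl H →L[ℝ] Dbl H :=
  pairL ((τ₁ • I + τ₂ • C).comp (fstD H)) (τ₃ • sndD H)

/-- The control operator `B ξ = ξ_I + ξ_c`. -/
def opB (H : Type*) [NormedAddCommGroup H] [InnerProductSpace ℝ H] : Dbl H →L[ℝ] H :=
  fstD H + sndD H

/-- The bounded part `R` of the Hamiltonian. With `A = -A₀ + α I` and `A(q) = A - a I`, and with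
`a` the value of the scalar function at `q`, the Hamiltonian is the operator matrix
`H(q) = [[A(q) - B F₃⁻¹ F₂, B F₃⁻¹ B*], [F₁ - F₂* F₃⁻¹ F₂, -(A(q) - B F₃⁻¹ F₂)*]]`
and equals `[[A, 0], [0, -A]] + R`. -/
def opR (I C : H →L[ℝ] H) (τ₁ τ₂ τ₃ Λ δ a : ℝ) : Dbl H →L[ℝ] Dbl H :=
  let B : Dbl H →L[ℝ] H := opB H
  let F1 : H →L[ℝ] H := opF1 I C τ₁ τ₂ τ₃ Λ δ a
  let F2 : H →L[ℝ] Dbl H := opF2 I τ₁ a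
  let F3inv : Dbl H →L[ℝ] Dbl H := (opF3 I C τ₁ τ₂ τ₃).inverse
  let BF : H →L[ℝ] H := B.comp (F3inv.comp F2)
  let id : H →L[ℝ] H := ContinuousLinearMap.id ℝ H
  pairL
    ((-BF - a • id).comp (fstD H) + (B.comp (F3inv.comp B.adjoint)).comp (sndD H))
    ((F1 - F2.adjoint.comp (F3inv.comp F2)).comp (fstD H) + (BF.adjoint + a • id).comp (sndD H))

/-! ## The stable subspaces -/

/-- Half of the spectral gap, `(λ_{N+1} - λ_N) / 2`. -/
def halfGap (lam : ℕ+ → ℝ) (N : ℕ+) : ℝ := (lam (N + 1) - lam N) / 2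

/-- The subspace of all `z₀` such that there is a bounded solution `z` on `[0, ∞)` with `z 0 = z₀`
of the Hamiltonian system `z' = H(ϑ^t q) z` with the coefficients
`τ₁ = 1`, `τ₂ = (1/4) (μ/Λ)²`, `τ₃ = 1`, where `μ` is the half of the spectral gap, and with
`α = (λ_N + λ_{N+1}) / 2`. -/
def stableSubspace {Q : Type*} [TopologicalSpace Q]
    (A₀ : H →ₗ.[ℝ] H) (lam : ℕ+ → ℝ) (e : HilbertBasis ℕ+ ℝ H)
    (ϑ : Flow ℝ≥0 Q) (a : Q → ℝ) (k N : ℕ+) (Λ δ : ℝ) (q : Q) : Submodule ℝ (Dbl H) :=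
  boundedSubspace
    (generatedSemigroup (shiftedNeg A₀ ((lam N + lam (N + 1)) / 2)))
    (fun t => opR (interProj e lam k N) (outerProj e lam k N)
      1 (1 / 4 * (halfGap lam N / Λ) ^ 2) 1 Λ δ (a (ϑ t.toNNReal q)))

end System

end

end SpatialAveraging

/-! Since the two projectors are diagonal in the basis `e` and `a` is scalar, the Hamiltonian system
splits into planar systems, one for each mode: `v' = ω v + b η`, `η' = -d v - ω η`, with constant
`b, d > 0` and with `ω = α - λ_j` on intermediate modes, `ω = α - λ_j - a` on the others. The form
of `F₁, F₂, F₃` removes `a` from the intermediate modes and makes `b, d` independent of time.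

For `j > N` the two inequalities of the hypothesis give `ω ≤ -c` with `b d < c ^ 2`
(`exists_mode_gap`). Such a planar system has a dichotomy: every initial value `v 0` extends to a
bounded solution (`exists_isModeSolution`, a contraction argument), and every bounded solution stays
in the cone `b η² ≤ d v²`, where `v²` decreases (`IsModeSolution.cone`, `IsModeSolution.sq_fst_le`).
So `v` and `η` are bounded by a fixed multiple of `|v 0|`, with the same factor for all `j > N`.
This uniformity lets the bounded modes be summed to a bounded solution in `H × H`, so that
membership in the stable subspace is decided mode by mode
(`IsDiagonalSystem.mem_boundedSubspace_iff`).

Nothing is needed about the first `N` modes. A stable vector with `v = 0` has `η_j = 0` for `j > N`,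
so it is determined by `N` numbers. Conversely, any `v` whose first `N` coordinates vanish is the
first component of a stable vector, so the sum with the vertical subspace contains the kernel of a
continuous map to `ℝ^N`; hence it is closed, of codimension at most `N`. -/

namespace SpatialAveraging

/-! ## Planar systems with a dichotomy -/

section Planar

/-- `(v, η)` solves `v' = ω v + b η`, `η' = -d v - ω η` on `[0, ∞)`. -/
structure IsModeSolution (ω : ℝ → ℝ) (b d : ℝ) (v η : ℝ → ℝ) : Prop where
  continuousOn_fst : ContinuousOn v (Ici 0)
  continuousOn_snd : ContinuousOn η (Ici 0)
  hasDerivAt_fst : ∀ t, 0 < t → HasDerivAt v (ω t * v t + b * η t) t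
  hasDerivAt_snd : ∀ t, 0 < t → HasDerivAt η (-(d * v t) - ω t * η t) t

theorem monotoneOn_Ici_of_hasDerivAt {f f' : ℝ → ℝ} (hf : ContinuousOn f (Ici 0))
    (hd : ∀ t, 0 < t → HasDerivAt f (f' t) t) (h : ∀ t, 0 < t → 0 ≤ f' t) :
    MonotoneOn f (Ici 0) := by
  refine monotoneOn_of_deriv_nonneg (convex_Ici 0) hf ?_ ?_ <;> rw [interior_Ici]
  · exact fun t ht => (hd t ht).differentiableAt.differentiableWithinAt
  · intro t ht
    rw [(hd t ht).deriv]
    exact h t ht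

/-- Expand `(√d x - √b y)² ≥ 0`, multiply by `√b √d`, and use `√b √d ≤ c`. -/
theorem two_mul_mul_le_of_mul_le_sq {b d c x y : ℝ} (hb : 0 ≤ b) (hd : 0 ≤ d) (hc : 0 ≤ c)
    (h : b * d ≤ c ^ 2) : 2 * (b * d) * (x * y) ≤ c * (d * x ^ 2 + b * y ^ 2) := by
  have h1 : 0 ≤ (Real.sqrt d * x - Real.sqrt b * y) ^ 2 := sq_nonneg _
  have hsb := Real.sq_sqrt hb
  have hsd := Real.sq_sqrt hd
  set p := Real.sqrt b with hp
  set r := Real.sqrt d with hr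
  have hp0 : 0 ≤ p := Real.sqrt_nonneg _
  have hr0 : 0 ≤ r := Real.sqrt_nonneg _
  rw [← hsb, ← hsd] at h ⊢
  have h2 : p * r ≤ c := by
    apply le_of_sq_le_sq _ hc
    calc (p * r) ^ 2 = p ^ 2 * r ^ 2 := by ring
      _ ≤ c ^ 2 := h
  have h3 : 0 ≤ r ^ 2 * x ^ 2 + p ^ 2 * y ^ 2 := by positivity
  have h4 := mul_le_mul_of_nonneg_right h2 h3
  have h5 := mul_nonneg (mul_nonneg hp0 hr0) h1
  nlinarith

/-- The form `P = b η² - d v²` satisfies `P' ≥ κ P` with `κ = 2 (c - √(b d)) > 0`. If it were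
positive at some time it would grow exponentially, while `P ≤ b K²`. -/
theorem IsModeSolution.cone {ω v η : ℝ → ℝ} {b d c K : ℝ} (h : IsModeSolution ω b d v η)
    (hb : 0 < b) (hd : 0 < d) (hc : 0 < c) (hbd : b * d < c ^ 2) (hω : ∀ t, ω t ≤ -c)
    (hη : ∀ t, 0 ≤ t → |η t| ≤ K) {t : ℝ} (ht : 0 ≤ t) :
    b * η t ^ 2 ≤ d * v t ^ 2 := by
  set c₀ := Real.sqrt (b * d) with hc₀
  have hc₀0 : 0 < c₀ := Real.sqrt_pos.2 (by positivity)
  have hsq : c₀ ^ 2 = b * d := Real.sq_sqrt (by positivity)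
  have hlt : c₀ < c := lt_of_pow_lt_pow_left₀ 2 hc.le (by rw [hsq]; exact hbd)
  set κ := 2 * (c - c₀) with hκ
  have hκ0 : 0 < κ := by linarith
  set P : ℝ → ℝ := fun s => b * η s ^ 2 - d * v s ^ 2 with hP
  have hPc : ContinuousOn P (Ici 0) :=
    ((h.continuousOn_snd.pow 2).const_mul b).sub ((h.continuousOn_fst.pow 2).const_mul d)
  have hPd : ∀ s, 0 < s → HasDerivAt P
      (-(2 * ω s) * (d * v s ^ 2 + b * η s ^ 2) - 4 * (b * d) * (v s * η s)) s := by
    intro s hs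
    have h1 := (((h.hasDerivAt_snd s hs).pow 2).const_mul b).sub
      (((h.hasDerivAt_fst s hs).pow 2).const_mul d)
    refine h1.congr_deriv ?_
    simp only [Nat.cast_ofNat]
    ring
  have hmono : MonotoneOn (fun s => P s * Real.exp (-κ * s)) (Ici 0) := by
    refine monotoneOn_Ici_of_hasDerivAt
      (f' := fun s => (-(2 * ω s) * (d * v s ^ 2 + b * η s ^ 2) - 4 * (b * d) * (v s * η s)
        - κ * P s) * Real.exp (-κ * s)) (hPc.mul (by fun_prop)) ?_ ?_
    · intro s hs
      have h2 : HasDerivAt (fun s => Real.exp (-κ * s)) (Real.exp (-κ * s) * (-κ * 1)) s :=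
        ((hasDerivAt_id s).const_mul (-κ)).exp
      refine ((hPd s hs).mul h2).congr_deriv ?_
      ring
    · intro s hs
      refine mul_nonneg ?_ (Real.exp_pos _).le
      have h3 := two_mul_mul_le_of_mul_le_sq (x := v s) (y := η s) hb.le hd.le hc₀0.le hsq.ge
      have h4 : 0 ≤ d * v s ^ 2 := by positivity
      have h5 : 0 ≤ b * η s ^ 2 := by positivity
      have h6 := mul_nonneg (show 0 ≤ -ω s - c by linarith [hω s]) (add_nonneg h4 h5)
      have h7 := mul_nonneg hκ0.le h4
      simp only [hP]
      nlinarith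
  by_contra hcon
  have hpos : 0 < P t := by simp only [hP]; linarith
  have hlim : Tendsto (fun s => P t * Real.exp (-κ * t) * Real.exp (κ * s)) atTop atTop :=
    (Real.tendsto_exp_atTop.comp (tendsto_id.const_mul_atTop hκ0)).const_mul_atTop
      (mul_pos hpos (Real.exp_pos _))
  obtain ⟨s, hs1, hs2⟩ := ((hlim.eventually_gt_atTop (b * K ^ 2)).and
    (eventually_ge_atTop t)).exists
  have h8 := hmono (mem_Ici.2 ht) (mem_Ici.2 (ht.trans hs2)) hs2
  have h9 := mul_le_mul_of_nonneg_right h8 (Real.exp_pos (κ * s)).le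
  simp only [mul_assoc, ← Real.exp_add] at h9
  rw [show -κ * s + κ * s = 0 by ring, Real.exp_zero, mul_one, Real.exp_add, ← mul_assoc] at h9
  have h10 : P s ≤ b * K ^ 2 := by
    have h11 : η s ^ 2 ≤ K ^ 2 := by
      rw [← sq_abs (η s)]
      exact pow_le_pow_left₀ (abs_nonneg _) (hη s (ht.trans hs2)) 2
    have h12 : 0 ≤ d * v s ^ 2 := by positivity
    simp only [hP]
    nlinarith
  linarith

/-- In the cone `b v η ≤ c v²`, so `(v²)' = 2 ω v² + 2 b v η ≤ 0`. -/
theorem IsModeSolution.sq_fst_le {ω v η : ℝ → ℝ} {b d c K : ℝ} (h : IsModeSolution ω b d v η)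
    (hb : 0 < b) (hd : 0 < d) (hc : 0 < c) (hbd : b * d < c ^ 2) (hω : ∀ t, ω t ≤ -c)
    (hη : ∀ t, 0 ≤ t → |η t| ≤ K) {t : ℝ} (ht : 0 ≤ t) :
    v t ^ 2 ≤ v 0 ^ 2 := by
  have hmono : MonotoneOn (fun s => -v s ^ 2) (Ici 0) := by
    refine monotoneOn_Ici_of_hasDerivAt
      (f' := fun s => -(2 * ω s * v s ^ 2 + 2 * b * (v s * η s)))
      (h.continuousOn_fst.pow 2).neg ?_ ?_
    · intro s hs
      refine ((h.hasDerivAt_fst s hs).pow 2).neg.congr_deriv ?_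
      simp only [Nat.cast_ofNat]
      ring
    · intro s hs
      have h1 := h.cone hb hd hc hbd hω hη hs.le
      have h2 := two_mul_mul_le_of_mul_le_sq (x := v s) (y := η s) hb.le hd.le hc.le hbd.le
      have h3 : 2 * (b * d) * (v s * η s) ≤ 2 * c * d * v s ^ 2 := by nlinarith
      have h4 : b * (v s * η s) ≤ c * v s ^ 2 := by
        refine le_of_mul_le_mul_left ?_ (show 0 < 2 * d by positivity)
        linarith
      have h5 := mul_nonneg (show 0 ≤ -ω s - c by linarith [hω s]) (sq_nonneg (v s))
      nlinarith
  have := hmono (mem_Ici.2 le_rfl) (mem_Ici.2 ht) ht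
  simpa using this

/-! ### Existence of bounded solutions -/

variable {ω : ℝ → ℝ} {c : ℝ}

/-- The solution of `E' = ω E`, `E 0 = 1`. -/
noncomputable def propagator (ω : ℝ → ℝ) (t : ℝ) : ℝ := Real.exp (∫ s in (0 : ℝ)..t, ω s)

theorem propagator_pos (ω : ℝ → ℝ) (t : ℝ) : 0 < propagator ω t := Real.exp_pos _

theorem propagator_zero (ω : ℝ → ℝ) : propagator ω 0 = 1 := by simp [propagator]

theorem hasDerivAt_propagator (hω : Continuous ω) (t : ℝ) :
    HasDerivAt (propagator ω) (ω t * propagator ω t) t := by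
  have h := (intervalIntegral.integral_hasDerivAt_right (hω.intervalIntegrable 0 t)
    (hω.stronglyMeasurableAtFilter _ _) hω.continuousAt).exp
  exact h.congr_deriv (mul_comm _ _)

theorem continuous_propagator (hω : Continuous ω) : Continuous (propagator ω) :=
  continuous_iff_continuousAt.2 fun t => (hasDerivAt_propagator hω t).continuousAt

theorem propagator_le (hω : Continuous ω) (h : ∀ t, ω t ≤ -c) {s t : ℝ} (hst : s ≤ t) :
    propagator ω t ≤ propagator ω s * Real.exp (-c * (t - s)) := by
  rw [propagator, propagator, ← Real.exp_add, Real.exp_le_exp,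
    ← intervalIntegral.integral_add_adjacent_intervals (hω.intervalIntegrable 0 s)
      (hω.intervalIntegrable s t)]
  have h1 := intervalIntegral.integral_mono_on hst (hω.intervalIntegrable s t)
    (intervalIntegrable_const (μ := volume) (c := -c)) (fun x _ => h x)
  rw [intervalIntegral.integral_const, smul_eq_mul] at h1
  linarith

/-- The solution of `y' = ω y + u`, `y 0 = 0`. -/
noncomputable def forwardSol (ω u : ℝ → ℝ) (t : ℝ) : ℝ :=
  propagator ω t * ∫ s in (0 : ℝ)..t, (propagator ω s)⁻¹ * u s

/-- The bounded solution of `y' = -ω y - u`, for `ω` negative. -/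
noncomputable def backwardSol (ω u : ℝ → ℝ) (t : ℝ) : ℝ :=
  (propagator ω t)⁻¹ * ∫ s in Ioi t, propagator ω s * u s

theorem continuous_inv_propagator_mul (hω : Continuous ω) {u : ℝ → ℝ} (hu : Continuous u) :
    Continuous fun s => (propagator ω s)⁻¹ * u s :=
  ((continuous_propagator hω).inv₀ fun s => (propagator_pos ω s).ne').mul hu

theorem hasDerivAt_forwardSol (hω : Continuous ω) {u : ℝ → ℝ} (hu : Continuous u) (t : ℝ) :
    HasDerivAt (forwardSol ω u) (ω t * forwardSol ω u t + u t) t := by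
  have hc := continuous_inv_propagator_mul hω hu
  have h := (hasDerivAt_propagator hω t).mul
    (intervalIntegral.integral_hasDerivAt_right (hc.intervalIntegrable 0 t)
      (hc.stronglyMeasurableAtFilter _ _) hc.continuousAt)
  refine h.congr_deriv ?_
  have := (propagator_pos ω t).ne'
  rw [forwardSol]
  field_simp

/-- The constant `M / c` is a supersolution: after division by the propagator, its difference with
the solution is nondecreasing and starts at `M / c ≥ 0`. -/
theorem forwardSol_le (hω : Continuous ω) (hc : 0 < c) (h : ∀ t, ω t ≤ -c) {u : ℝ → ℝ}
    (hu : Continuous u) {M : ℝ} (hM : ∀ t, u t ≤ M) (hM0 : 0 ≤ M) {t : ℝ} (ht : 0 ≤ t) :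
    forwardSol ω u t ≤ M / c := by
  have hcu := continuous_inv_propagator_mul hω hu
  have hdI : ∀ s, HasDerivAt (fun s => M / c * (propagator ω s)⁻¹
      - ∫ r in (0 : ℝ)..s, (propagator ω r)⁻¹ * u r)
      ((propagator ω s)⁻¹ * (M / c * (-ω s) - u s)) s := by
    intro s
    have h1 := (((hasDerivAt_propagator hω s).inv (propagator_pos ω s).ne').const_mul (M / c)).sub
      (intervalIntegral.integral_hasDerivAt_right (hcu.intervalIntegrable 0 s)
        (hcu.stronglyMeasurableAtFilter _ _) hcu.continuousAt)
    refine h1.congr_deriv ?_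
    have := (propagator_pos ω s).ne'
    field_simp
  have hmono := monotoneOn_Ici_of_hasDerivAt
    (fun s _ => (hdI s).continuousAt.continuousWithinAt) (fun s _ => hdI s) (by
      intro s _
      refine mul_nonneg (inv_pos.2 (propagator_pos ω s)).le ?_
      have h1 : M / c * c ≤ M / c * (-ω s) :=
        mul_le_mul_of_nonneg_left (by linarith [h s]) (by positivity)
      rw [div_mul_cancel₀ _ hc.ne'] at h1
      linarith [hM s])
  have h2 := hmono (mem_Ici.2 le_rfl) (mem_Ici.2 ht) ht
  simp only [intervalIntegral.integral_same, propagator_zero, inv_one, mul_one, sub_zero] at h2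
  have h3 : 0 ≤ M / c := by positivity
  rw [forwardSol]
  have h4 := propagator_pos ω t
  have h5 : ∫ r in (0 : ℝ)..t, (propagator ω r)⁻¹ * u r ≤ M / c * (propagator ω t)⁻¹ := by
    linarith
  calc _ ≤ propagator ω t * (M / c * (propagator ω t)⁻¹) := mul_le_mul_of_nonneg_left h5 h4.le
    _ = M / c := by field_simp

theorem forwardSol_neg (ω u : ℝ → ℝ) (t : ℝ) :
    forwardSol ω (fun s => -u s) t = -forwardSol ω u t := by
  simp [forwardSol]

theorem abs_forwardSol_le (hω : Continuous ω) (hc : 0 < c) (h : ∀ t, ω t ≤ -c) {u : ℝ → ℝ}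
    (hu : Continuous u) {M : ℝ} (hM : ∀ t, |u t| ≤ M) {t : ℝ} (ht : 0 ≤ t) :
    |forwardSol ω u t| ≤ M / c := by
  have hM0 : 0 ≤ M := (abs_nonneg _).trans (hM 0)
  rw [abs_le']
  refine ⟨forwardSol_le hω hc h hu (fun s => (le_abs_self _).trans (hM s)) hM0 ht, ?_⟩
  rw [← forwardSol_neg]
  exact forwardSol_le hω hc h hu.neg (fun s => (neg_le_abs _).trans (hM s)) hM0 ht

theorem forwardSol_sub (hω : Continuous ω) {u w : ℝ → ℝ} (hu : Continuous u) (hw : Continuous w)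
    (t : ℝ) : forwardSol ω (fun s => u s - w s) t = forwardSol ω u t - forwardSol ω w t := by
  simp only [forwardSol, mul_sub]
  rw [intervalIntegral.integral_sub
    ((continuous_inv_propagator_mul hω hu).intervalIntegrable 0 t)
    ((continuous_inv_propagator_mul hω hw).intervalIntegrable 0 t), mul_sub]

theorem abs_propagator_mul_le (hω : Continuous ω) (h : ∀ t, ω t ≤ -c) {u : ℝ → ℝ} {M : ℝ}
    (hM : ∀ t, |u t| ≤ M) {s t : ℝ} (hst : t ≤ s) :
    |propagator ω s * u s| ≤ propagator ω t * Real.exp (c * t) * M * Real.exp (-c * s) := by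
  rw [abs_mul, abs_of_pos (propagator_pos ω s)]
  calc _ ≤ (propagator ω t * Real.exp (-c * (s - t))) * M :=
        mul_le_mul (propagator_le hω h hst) (hM s) (abs_nonneg _)
          (mul_pos (propagator_pos ω t) (Real.exp_pos _)).le
    _ = _ := by
        rw [show -c * (s - t) = c * t + -c * s by ring, Real.exp_add]
        ring

theorem integrableOn_propagator_mul (hω : Continuous ω) (hc : 0 < c) (h : ∀ t, ω t ≤ -c)
    {u : ℝ → ℝ} (hu : Continuous u) {M : ℝ} (hM : ∀ t, |u t| ≤ M) (t : ℝ) :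
    IntegrableOn (fun s => propagator ω s * u s) (Ioi t) := by
  refine ((integrableOn_exp_mul_Ioi (neg_lt_zero.2 hc) t).const_mul
    (propagator ω t * Real.exp (c * t) * M)).mono'
    ((continuous_propagator hω).mul hu).aestronglyMeasurable ?_
  filter_upwards [ae_restrict_mem measurableSet_Ioi] with s hs
  exact abs_propagator_mul_le hω h hM (le_of_lt hs)

/-- The exponential majorant of the integrand is integrated exactly. The constant agrees with the
one for `forwardSol`, so the composition of the two has norm at most `1 / c ^ 2`. -/
theorem abs_backwardSol_le (hω : Continuous ω) (hc : 0 < c) (h : ∀ t, ω t ≤ -c)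
    {u : ℝ → ℝ} {M : ℝ} (hM : ∀ t, |u t| ≤ M) (t : ℝ) :
    |backwardSol ω u t| ≤ M / c := by
  have h1 : ‖∫ s in Ioi t, propagator ω s * u s‖ ≤
      ∫ s in Ioi t, propagator ω t * Real.exp (c * t) * M * Real.exp (-c * s) := by
    refine norm_integral_le_of_norm_le
      ((integrableOn_exp_mul_Ioi (neg_lt_zero.2 hc) t).const_mul _) ?_
    filter_upwards [ae_restrict_mem measurableSet_Ioi] with s hs
    exact abs_propagator_mul_le hω h hM (le_of_lt hs)
  rw [integral_const_mul, integral_exp_mul_Ioi (neg_lt_zero.2 hc), Real.norm_eq_abs] at h1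
  have hp := propagator_pos ω t
  rw [backwardSol, abs_mul, abs_of_pos (inv_pos.2 hp)]
  refine (mul_le_mul_of_nonneg_left h1 (inv_pos.2 hp).le).trans_eq ?_
  have h2 : Real.exp (c * t) * Real.exp (-c * t) = 1 := by
    rw [← Real.exp_add, show c * t + -c * t = 0 by ring, Real.exp_zero]
  rw [neg_div_neg_eq]
  calc _ = (propagator ω t)⁻¹ * propagator ω t * M * (Real.exp (c * t) * Real.exp (-c * t)) / c := by
        ring
    _ = M / c := by rw [h2, inv_mul_cancel₀ hp.ne']; ring

theorem backwardSol_sub (hω : Continuous ω) (hc : 0 < c) (h : ∀ t, ω t ≤ -c)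
    {u w : ℝ → ℝ} (hu : Continuous u) (hw : Continuous w) {M K : ℝ} (hM : ∀ t, |u t| ≤ M)
    (hK : ∀ t, |w t| ≤ K) (t : ℝ) :
    backwardSol ω (fun s => u s - w s) t = backwardSol ω u t - backwardSol ω w t := by
  simp only [backwardSol, mul_sub]
  rw [integral_sub (integrableOn_propagator_mul hω hc h hu hM t)
    (integrableOn_propagator_mul hω hc h hw hK t), mul_sub]

theorem hasDerivAt_backwardSol (hω : Continuous ω) (hc : 0 < c) (h : ∀ t, ω t ≤ -c)
    {u : ℝ → ℝ} (hu : Continuous u) {M : ℝ} (hM : ∀ t, |u t| ≤ M) (t : ℝ) :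
    HasDerivAt (backwardSol ω u) (-ω t * backwardSol ω u t - u t) t := by
  have hi := integrableOn_propagator_mul hω hc h hu hM
  have hcu : Continuous fun s => propagator ω s * u s := (continuous_propagator hω).mul hu
  have heq : (fun t => ∫ s in Ioi t, propagator ω s * u s) = fun t =>
      (∫ s in Ioi (0 : ℝ), propagator ω s * u s) - ∫ s in (0 : ℝ)..t, propagator ω s * u s := by
    funext r
    rw [← intervalIntegral.integral_interval_add_Ioi' (hcu.intervalIntegrable 0 r) (hi r)]
    ring
  have h1 : HasDerivAt (fun t => ∫ s in Ioi t, propagator ω s * u s)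
      (-(propagator ω t * u t)) t := by
    rw [heq]
    exact (intervalIntegral.integral_hasDerivAt_right (hcu.intervalIntegrable 0 t)
      (hcu.stronglyMeasurableAtFilter _ _) hcu.continuousAt).const_sub _
  have h2 := ((hasDerivAt_propagator hω t).inv (propagator_pos ω t).ne').mul h1
  refine h2.congr_deriv ?_
  have := (propagator_pos ω t).ne'
  simp only [backwardSol, Pi.inv_apply]
  field_simp
  ring

/-- The second equation forces `η = d * backwardSol ω v` for bounded solutions. Substitution into
the first leaves a fixed-point equation for `v` among bounded continuous functions, with Lipschitz
constant `b d / c ^ 2 < 1`. -/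
theorem exists_isModeSolution (hω : Continuous ω) (hc : 0 < c) (h : ∀ t, ω t ≤ -c)
    {b d : ℝ} (hb : 0 < b) (hd : 0 < d) (hbd : b * d < c ^ 2) (v₀ : ℝ) :
    ∃ v η : ℝ → ℝ, IsModeSolution ω b d v η ∧ v 0 = v₀ ∧
      ∃ K, ∀ t, 0 ≤ t → |v t| ≤ K ∧ |η t| ≤ K := by
  have hub : ∀ u : BoundedContinuousFunction ℝ ℝ, ∀ t, |u t| ≤ ‖u‖ := fun u t => u.norm_coe_le_norm t
  have hBc : ∀ u : BoundedContinuousFunction ℝ ℝ, Continuous (backwardSol ω u) := fun u =>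
    continuous_iff_continuousAt.2 fun t =>
      (hasDerivAt_backwardSol hω hc h u.continuous (hub u) t).continuousAt
  have hFc : ∀ u : ℝ → ℝ, Continuous u → Continuous (forwardSol ω u) := fun u hu =>
    continuous_iff_continuousAt.2 fun t => (hasDerivAt_forwardSol hω hu t).continuousAt
  have hFB : ∀ u : BoundedContinuousFunction ℝ ℝ, ∀ t, 0 ≤ t →
      |forwardSol ω (backwardSol ω u) t| ≤ ‖u‖ / c / c := fun u t ht =>
    abs_forwardSol_le hω hc h (hBc u) (abs_backwardSol_le hω hc h (hub u)) ht
  have hE : ∀ t, 0 ≤ t → |propagator ω t| ≤ 1 := by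
    intro t ht
    rw [abs_of_pos (propagator_pos ω t)]
    refine (propagator_le hω h ht).trans ?_
    rw [propagator_zero, one_mul, Real.exp_le_one_iff]
    nlinarith
  -- The forward bounds hold only for `t ≥ 0`. Freezing the time at `max t 0` keeps the image
  -- bounded on all of `ℝ`; negative times play no role in the solution.
  let Φ : BoundedContinuousFunction ℝ ℝ → BoundedContinuousFunction ℝ ℝ := fun u =>
    BoundedContinuousFunction.ofNormedAddCommGroup
      (fun t => propagator ω (max t 0) * v₀
        + b * d * forwardSol ω (backwardSol ω u) (max t 0))
      (by
        have h1 := continuous_propagator hω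
        have h2 := hFc _ (hBc u)
        fun_prop) (|v₀| + b * d * (‖u‖ / c / c)) (by
      intro t
      have ht : 0 ≤ max t 0 := le_max_right _ _
      rw [Real.norm_eq_abs]
      refine (abs_add_le _ _).trans (add_le_add ?_ ?_)
      · rw [abs_mul]
        exact mul_le_of_le_one_left (abs_nonneg _) (hE _ ht)
      · rw [abs_mul, abs_of_pos (mul_pos hb hd)]
        exact mul_le_mul_of_nonneg_left (hFB u _ ht) (mul_pos hb hd).le)
  have hΦ : ∀ u t, Φ u t = propagator ω (max t 0) * v₀
        + b * d * forwardSol ω (backwardSol ω u) (max t 0) := fun u t => rfl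
  have hq : b * d / c ^ 2 < 1 := (div_lt_one (by positivity)).2 hbd
  have hq0 : 0 ≤ b * d / c ^ 2 := by positivity
  have hcontr : ContractingWith ⟨b * d / c ^ 2, hq0⟩ Φ := by
    refine ⟨by exact_mod_cast hq, LipschitzWith.of_dist_le_mul fun u w => ?_⟩
    rw [BoundedContinuousFunction.dist_le (by positivity)]
    intro t
    have ht : 0 ≤ max t 0 := le_max_right _ _
    have h1 := hFB (u - w) _ ht
    have h2 : backwardSol ω (u - w : BoundedContinuousFunction ℝ ℝ) =
        fun s => backwardSol ω u s - backwardSol ω w s := by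
      funext s
      exact backwardSol_sub hω hc h u.continuous w.continuous (hub u) (hub w) s
    rw [h2, forwardSol_sub hω (hBc u) (hBc w)] at h1
    rw [Real.dist_eq, hΦ, hΦ, add_sub_add_left_eq_sub, ← mul_sub, abs_mul,
      abs_of_pos (mul_pos hb hd), dist_eq_norm]
    refine (mul_le_mul_of_nonneg_left h1 (mul_pos hb hd).le).trans_eq ?_
    change _ = b * d / c ^ 2 * _
    field_simp
  obtain ⟨u, hu, -⟩ := hcontr.exists_fixedPoint 0 (edist_ne_top _ _)
  have hfix : ∀ t, 0 ≤ t → u t = propagator ω t * v₀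
        + b * d * forwardSol ω (backwardSol ω u) t := by
    intro t ht
    have h1 := hΦ u t
    rwa [hu.eq, max_eq_left ht] at h1
  refine ⟨u, fun t => d * backwardSol ω u t, ⟨u.continuous.continuousOn,
    ((hBc u).const_mul d).continuousOn, fun t ht => ?_, fun t _ => ?_⟩, ?_,
    max ‖u‖ (d * (‖u‖ / c)), fun t _ => ⟨(hub u t).trans (le_max_left _ _), ?_⟩⟩
  · have h1 := ((hasDerivAt_propagator hω t).mul_const v₀).add
      ((hasDerivAt_forwardSol hω (hBc u) t).const_mul (b * d))
    refine (h1.congr_of_eventuallyEq ?_).congr_deriv ?_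
    · filter_upwards [lt_mem_nhds ht] with s hs
      exact hfix s hs.le
    · rw [hfix t ht.le]
      ring
  · refine ((hasDerivAt_backwardSol hω hc h u.continuous (hub u) t).const_mul d).congr_deriv ?_
    ring
  · rw [hfix 0 le_rfl]
    simp [propagator_zero, forwardSol]
  · rw [abs_mul, abs_of_pos hd]
    exact (mul_le_mul_of_nonneg_left (abs_backwardSol_le hω hc h (hub u) t) hd.le).trans
      (le_max_right _ _)

/-- The initial data of the bounded solutions of `v' = ω v + b η`, `η' = -d v - ω η`. -/
def modeSubspace (ω : ℝ → ℝ) (b d : ℝ) : Submodule ℝ (ℝ × ℝ) where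
  carrier := {p | ∃ v η : ℝ → ℝ, IsModeSolution ω b d v η ∧ v 0 = p.1 ∧ η 0 = p.2 ∧
    ∃ K, ∀ t, 0 ≤ t → |v t| ≤ K ∧ |η t| ≤ K}
  zero_mem' := ⟨fun _ => 0, fun _ => 0,
    ⟨continuousOn_const, continuousOn_const, fun t _ => by simpa using hasDerivAt_const t (0 : ℝ),
      fun t _ => by simpa using hasDerivAt_const t (0 : ℝ)⟩, rfl, rfl, 0, by simp⟩
  add_mem' := by
    rintro p p' ⟨v, η, h, hv, hη, K, hK⟩ ⟨v', η', h', hv', hη', K', hK'⟩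
    refine ⟨fun t => v t + v' t, fun t => η t + η' t,
      ⟨h.continuousOn_fst.add h'.continuousOn_fst, h.continuousOn_snd.add h'.continuousOn_snd,
        fun t ht => ?_, fun t ht => ?_⟩, by simp [hv, hv'], by simp [hη, hη'], K + K',
      fun t ht => ⟨(abs_add_le _ _).trans (add_le_add (hK t ht).1 (hK' t ht).1),
        (abs_add_le _ _).trans (add_le_add (hK t ht).2 (hK' t ht).2)⟩⟩
    · refine ((h.hasDerivAt_fst t ht).add (h'.hasDerivAt_fst t ht)).congr_deriv ?_
      ring
    · refine ((h.hasDerivAt_snd t ht).add (h'.hasDerivAt_snd t ht)).congr_deriv ?_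
      ring
  smul_mem' := by
    rintro r p ⟨v, η, h, hv, hη, K, hK⟩
    refine ⟨fun t => r * v t, fun t => r * η t,
      ⟨h.continuousOn_fst.const_mul r, h.continuousOn_snd.const_mul r,
        fun t ht => ?_, fun t ht => ?_⟩, by simp [hv], by simp [hη], |r| * K,
      fun t ht => ⟨?_, ?_⟩⟩
    · refine ((h.hasDerivAt_fst t ht).const_mul r).congr_deriv ?_
      ring
    · refine ((h.hasDerivAt_snd t ht).const_mul r).congr_deriv ?_
      ring
    · rw [abs_mul]
      exact mul_le_mul_of_nonneg_left (hK t ht).1 (abs_nonneg r)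
    · rw [abs_mul]
      exact mul_le_mul_of_nonneg_left (hK t ht).2 (abs_nonneg r)

end Planar

/-! ## Coordinates with respect to a Hilbert basis -/

section Coordinates

variable {H : Type*} [NormedAddCommGroup H] [InnerProductSpace ℝ H] {ι : Type*}
  (e : HilbertBasis ι ℝ H)

theorem ext_coord {x y : H} (h : ∀ j, ⟪e j, x⟫_ℝ = ⟪e j, y⟫_ℝ) : x = y := by
  apply e.repr.injective
  ext j
  rw [e.repr_apply_apply, e.repr_apply_apply, h]

theorem hasSum_sq_coord (x : H) : HasSum (fun j => ⟪e j, x⟫_ℝ ^ 2) (‖x‖ ^ 2) := by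
  have h := e.hasSum_inner_mul_inner x x
  rw [real_inner_self_eq_norm_sq] at h
  refine h.congr_fun ?_
  intro j
  rw [real_inner_comm, sq]

theorem abs_coord_le (x : H) (j : ι) : |⟪e j, x⟫_ℝ| ≤ ‖x‖ := by
  have h := abs_real_inner_le_norm (e j) x
  rwa [e.orthonormal.norm_eq_one, one_mul] at h

theorem inner_basis (i j : ι) [Decidable (i = j)] : ⟪e i, e j⟫_ℝ = if i = j then 1 else 0 := by
  classical
  rw [orthonormal_iff_ite.1 e.orthonormal i j]
  congr

theorem exists_coord {f : ι → ℝ} (hf : Summable fun j => f j ^ 2) :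
    ∃ x : H, ∀ j, ⟪e j, x⟫_ℝ = f j := by
  have hm : Memℓp f 2 := by
    refine memℓp_gen ?_
    simpa using hf
  refine ⟨e.repr.symm ⟨f, hm⟩, fun j => ?_⟩
  rw [← e.repr_apply_apply, LinearIsometryEquiv.apply_symm_apply]

/-- Dominated convergence in Parseval's sum for `‖z t - x‖ ^ 2`. -/
theorem tendsto_of_coord {α : Type*} {l : Filter α} {z : α → H} {x : H} {M : ι → ℝ}
    (hM : Summable fun j => M j ^ 2)
    (hz : ∀ j, Tendsto (fun t => ⟪e j, z t⟫_ℝ) l (𝓝 ⟪e j, x⟫_ℝ))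
    (hb : ∀ᶠ t in l, ∀ j, |⟪e j, z t - x⟫_ℝ| ≤ M j) : Tendsto z l (𝓝 x) := by
  rw [tendsto_iff_norm_sub_tendsto_zero]
  have h1 : Tendsto (fun t => ∑' j, ⟪e j, z t - x⟫_ℝ ^ 2) l (𝓝 (∑' _ : ι, (0 : ℝ))) := by
    refine tendsto_tsum_of_dominated_convergence hM (fun j => ?_) ?_
    · have h2 := ((hz j).sub_const ⟪e j, x⟫_ℝ).pow 2
      simpa [inner_sub_right] using h2
    · filter_upwards [hb] with t ht j
      rw [Real.norm_eq_abs, abs_pow]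
      exact pow_le_pow_left₀ (abs_nonneg _) (ht j) 2
  rw [tsum_zero] at h1
  have h3 := (Real.continuous_sqrt.tendsto 0).comp h1
  rw [Real.sqrt_zero] at h3
  refine h3.congr fun t => ?_
  simp only [Function.comp_apply]
  rw [(hasSum_sq_coord e _).tsum_eq, Real.sqrt_sq (norm_nonneg _)]

theorem continuousOn_of_coord {α : Type*} [TopologicalSpace α] {s : Set α} {z : α → H}
    {M : ι → ℝ} (hM : Summable fun j => M j ^ 2)
    (hz : ∀ j, ContinuousOn (fun t => ⟪e j, z t⟫_ℝ) s)
    (hb : ∀ t ∈ s, ∀ j, |⟪e j, z t⟫_ℝ| ≤ M j) : ContinuousOn z s := by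
  intro t₀ ht₀
  refine tendsto_of_coord e (M := fun j => 2 * M j) ?_ (fun j => hz j t₀ ht₀) ?_
  · simpa only [mul_pow] using hM.mul_left (2 ^ 2)
  · filter_upwards [self_mem_nhdsWithin] with t ht j
    rw [inner_sub_right]
    refine (abs_sub _ _).trans ?_
    linarith [hb t ht j, hb t₀ ht₀ j]

theorem norm_le_of_abs_coord_le {x y : H} {C : ℝ} (hC : 0 ≤ C)
    (h : ∀ j, |⟪e j, x⟫_ℝ| ≤ C * |⟪e j, y⟫_ℝ|) : ‖x‖ ≤ C * ‖y‖ := by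
  refine le_of_sq_le_sq ?_ (by positivity)
  rw [mul_pow]
  refine hasSum_le (fun j => ?_) (hasSum_sq_coord e x) ((hasSum_sq_coord e y).mul_left (C ^ 2))
  rw [← sq_abs, ← sq_abs ⟪e j, y⟫_ℝ, ← mul_pow]
  exact pow_le_pow_left₀ (abs_nonneg _) (h j) 2

theorem exists_diagonal {m : ι → ℝ} {C : ℝ} (hC : 0 ≤ C) (hm : ∀ j, |m j| ≤ C) :
    ∃ T : H →L[ℝ] H, ∀ j x, ⟪e j, T x⟫_ℝ = m j * ⟪e j, x⟫_ℝ := by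
  have h1 : ∀ x : H, ∃ y : H, ∀ j, ⟪e j, y⟫_ℝ = m j * ⟪e j, x⟫_ℝ := by
    intro x
    refine exists_coord e (((hasSum_sq_coord e x).summable.mul_left (C ^ 2)).of_nonneg_of_le
      (fun j => sq_nonneg _) fun j => ?_)
    rw [mul_pow]
    refine mul_le_mul_of_nonneg_right ?_ (sq_nonneg _)
    rw [← sq_abs]
    exact pow_le_pow_left₀ (abs_nonneg _) (hm j) 2
  choose T hT using h1
  refine ⟨LinearMap.mkContinuous
    { toFun := T
      map_add' := fun x y => ext_coord e fun j => by
        simp only [hT, inner_add_right]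
        ring
      map_smul' := fun r x => ext_coord e fun j => by
        simp only [hT, inner_smul_right, RingHom.id_apply]
        ring } C fun x => norm_le_of_abs_coord_le e hC fun j => ?_, fun j x => hT x j⟩
  change |⟪e j, T x⟫_ℝ| ≤ _
  rw [hT, abs_mul]
  exact mul_le_mul_of_nonneg_right (hm j) (abs_nonneg _)

/-- Both sides are continuous functionals of `x` which agree on the basis, whose span is dense. -/
theorem coord_of_apply_basis {T : H →L[ℝ] H} {m : ι → ℝ} (h : ∀ j, T (e j) = m j • e j) (j : ι)
    (x : H) : ⟪e j, T x⟫_ℝ = m j * ⟪e j, x⟫_ℝ := by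
  classical
  have h1 : (innerSL ℝ (e j)).comp T = m j • innerSL ℝ (e j) := by
    refine ContinuousLinearMap.ext_on (s := range e) ?_ ?_
    · rw [Submodule.dense_iff_topologicalClosure_eq_top]
      exact e.dense_span
    · rintro _ ⟨i, rfl⟩
      simp only [ContinuousLinearMap.comp_apply, innerSL_apply_apply, h, inner_smul_right,
        smul_apply, inner_basis, smul_eq_mul]
      split_ifs with hij
      · rw [hij]
      · simp
  exact congrArg (fun f : H →L[ℝ] ℝ => f x) h1

end Coordinates

/-! ## Semigroups with an eigenbasis -/

section DiagonalSemigroup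

variable {H : Type*} [NormedAddCommGroup H] [InnerProductSpace ℝ H] {ι : Type*}
  {e : HilbertBasis ι ℝ H}

theorem exists_diagonalSemigroup (e : HilbertBasis ι ℝ H) {ν : ι → ℝ} {C : ℝ} (hν : ∀ j, ν j ≤ C) :
    ∃ G : ℝ → H →L[ℝ] H, ∀ t, 0 ≤ t → ∀ j x, ⟪e j, G t x⟫_ℝ = Real.exp (ν j * t) * ⟪e j, x⟫_ℝ := by
  have h : ∀ t : ℝ, ∃ T : H →L[ℝ] H, 0 ≤ t →
      ∀ j x, ⟪e j, T x⟫_ℝ = Real.exp (ν j * t) * ⟪e j, x⟫_ℝ := by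
    intro t
    by_cases ht : 0 ≤ t
    · obtain ⟨T, hT⟩ := exists_diagonal e (m := fun j => Real.exp (ν j * t))
        (Real.exp_pos (C * t)).le (fun j => by
          rw [abs_of_pos (Real.exp_pos _), Real.exp_le_exp]
          exact mul_le_mul_of_nonneg_right (hν j) ht)
      exact ⟨T, fun _ => hT⟩
    · exact ⟨0, fun h => absurd h ht⟩
  choose G hG using h
  exact ⟨G, hG⟩

theorem exp_mul_le_exp_abs_mul {ν C s t : ℝ} (hν : ν ≤ C) (hs : 0 ≤ s) (hst : s ≤ t) :
    Real.exp (ν * s) ≤ Real.exp (|C| * t) := by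
  rw [Real.exp_le_exp]
  exact (mul_le_mul_of_nonneg_right (hν.trans (le_abs_self C)) hs).trans
    (mul_le_mul_of_nonneg_left hst (abs_nonneg C))

theorem isC0Semigroup_of_diagonal {ν : ι → ℝ} {C : ℝ} (hν : ∀ j, ν j ≤ C) {G : ℝ → H →L[ℝ] H}
    (hG : ∀ t, 0 ≤ t → ∀ j x, ⟪e j, G t x⟫_ℝ = Real.exp (ν j * t) * ⟪e j, x⟫_ℝ) :
    IsC0Semigroup G where
  zero := by
    ext x
    refine ext_coord e fun j => ?_
    simp [hG 0 le_rfl]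
  add := by
    intro s t hs ht
    ext x
    refine ext_coord e fun j => ?_
    rw [hG _ (add_nonneg hs ht), ContinuousLinearMap.comp_apply, hG s hs, hG t ht, mul_add,
      Real.exp_add, mul_assoc]
  continuousOn := by
    intro x t₀ ht₀
    -- The `ν j` may be positive, so a common majorant of the coordinates is available only on
    -- bounded time intervals; continuity is local.
    have h1 : ContinuousOn (fun t => G t x) (Icc 0 (t₀ + 1)) := by
      refine continuousOn_of_coord e
        (M := fun j => Real.exp (|C| * (t₀ + 1)) * |⟪e j, x⟫_ℝ|) ?_ (fun j => ?_) ?_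
      · simpa only [mul_pow, sq_abs] using (hasSum_sq_coord e x).summable.mul_left _
      · have h2 : ContinuousOn (fun t => Real.exp (ν j * t) * ⟪e j, x⟫_ℝ) (Icc 0 (t₀ + 1)) := by
          fun_prop
        exact h2.congr fun t ht => hG t ht.1 j x
      · intro t ht j
        rw [hG t ht.1, abs_mul, abs_of_pos (Real.exp_pos _)]
        exact mul_le_mul_of_nonneg_right (exp_mul_le_exp_abs_mul (hν j) ht.1 ht.2) (abs_nonneg _)
    refine (h1 t₀ ⟨ht₀, by linarith⟩).mono_of_mem_nhdsWithin ?_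
    rw [← Ici_inter_Iic]
    exact inter_mem self_mem_nhdsWithin (mem_nhdsWithin_of_mem_nhds (Iic_mem_nhds (by linarith)))

/-- Bounds the difference quotient of `exp (ν t)` by a fixed multiple of `|ν|` even when `ν` is
unbounded below. -/
theorem abs_exp_sub_one_le (u : ℝ) : |Real.exp u - 1| ≤ |u| * max 1 (Real.exp u) := by
  have h1 := Real.add_one_le_exp u
  have h2 := Real.add_one_le_exp (-u)
  have h3 : Real.exp (-u) * Real.exp u = 1 := by rw [← Real.exp_add]; simp
  have h4 := Real.exp_pos u
  rcases le_total 0 u with hu | hu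
  · rw [abs_of_nonneg (by linarith), abs_of_nonneg hu]
    refine le_trans ?_ (mul_le_mul_of_nonneg_left (le_max_right _ _) hu)
    nlinarith
  · rw [abs_of_nonpos (by rw [sub_nonpos, Real.exp_le_one_iff]; exact hu), abs_of_nonpos hu]
    refine le_trans ?_ (mul_le_mul_of_nonneg_left (le_max_left _ _) (neg_nonneg.2 hu))
    linarith

/-- The difference quotients converge in each coordinate to `ν j * ⟪e j, x⟫`. If these are the
coordinates of some `y` in `H`, they supply the square-summable majorant, up to a constant;
conversely a limit in norm has these coordinates. -/
theorem isGenerator_of_diagonal {ν : ι → ℝ} {C : ℝ} (hν : ∀ j, ν j ≤ C) {G : ℝ → H →L[ℝ] H}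
    (hG : ∀ t, 0 ≤ t → ∀ j x, ⟪e j, G t x⟫_ℝ = Real.exp (ν j * t) * ⟪e j, x⟫_ℝ)
    {A : H →ₗ.[ℝ] H} (hA : ∀ x y, (x, y) ∈ A.graph ↔ ∀ j, ⟪e j, y⟫_ℝ = ν j * ⟪e j, x⟫_ℝ) :
    IsGenerator G A := by
  have hcoord : ∀ t, 0 < t → ∀ j x, ⟪e j, t⁻¹ • (G t x - x)⟫_ℝ =
      t⁻¹ * (Real.exp (ν j * t) - 1) * ⟪e j, x⟫_ℝ := by
    intro t ht j x
    rw [inner_smul_right, inner_sub_right, hG t ht.le]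
    ring
  have hlim : ∀ j x, Tendsto (fun t : ℝ => ⟪e j, t⁻¹ • (G t x - x)⟫_ℝ) (𝓝[>] 0)
      (𝓝 (ν j * ⟪e j, x⟫_ℝ)) := by
    intro j x
    have h1 : HasDerivAt (fun t : ℝ => Real.exp (ν j * t)) (ν j) 0 := by
      simpa using ((hasDerivAt_id (0 : ℝ)).const_mul (ν j)).exp
    have h2 := h1.hasDerivWithinAt (s := Ioi 0)
    rw [hasDerivWithinAt_iff_tendsto_slope' (by simp)] at h2
    refine (h2.mul_const ⟪e j, x⟫_ℝ).congr' ?_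
    filter_upwards [self_mem_nhdsWithin] with t ht
    rw [hcoord t ht, slope_def_field]
    simp [div_eq_inv_mul]
  intro x y
  rw [hA]
  constructor
  · intro h
    refine tendsto_of_coord e (M := fun j => (Real.exp |C| + 1) * |⟪e j, y⟫_ℝ|) ?_
      (fun j => by rw [h]; exact hlim j x) ?_
    · simpa only [mul_pow, sq_abs] using (hasSum_sq_coord e y).summable.mul_left _
    · filter_upwards [Ioo_mem_nhdsGT (zero_lt_one (α := ℝ))] with t ht j
      rw [inner_sub_right]
      refine (abs_sub _ _).trans ?_
      rw [add_mul, one_mul, add_le_add_iff_right, hcoord t ht.1, h, abs_mul, abs_mul, abs_mul,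
        ← mul_assoc, abs_of_pos (inv_pos.2 ht.1)]
      refine mul_le_mul_of_nonneg_right ?_ (abs_nonneg _)
      have h1 := abs_exp_sub_one_le (ν j * t)
      have h2 : max 1 (Real.exp (ν j * t)) ≤ Real.exp |C| := by
        refine max_le (Real.one_le_exp (abs_nonneg _)) ?_
        simpa using exp_mul_le_exp_abs_mul (hν j) ht.1.le ht.2.le
      rw [inv_mul_le_iff₀ ht.1]
      refine h1.trans ((mul_le_mul_of_nonneg_left h2 (abs_nonneg _)).trans_eq ?_)
      rw [abs_mul, abs_of_pos ht.1]
      ring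
  · intro h j
    exact tendsto_nhds_unique (((innerSL ℝ (e j)).continuous.tendsto y).comp h) (hlim j x)

/-- The curve `exp (-ν s) • G s x` has right derivative zero, hence is constant. -/
theorem IsC0Semigroup.apply_eigenvector {G : ℝ → H →L[ℝ] H} (hG : IsC0Semigroup G)
    {A : H →ₗ.[ℝ] H} (hA : IsGenerator G A) {x : H} {ν : ℝ} (hx : (x, ν • x) ∈ A.graph)
    {t : ℝ} (ht : 0 ≤ t) : G t x = Real.exp (ν * t) • x := by
  set y : ℝ → H := fun s => Real.exp (-ν * s) • G s x with hy
  have hexp : ∀ s, HasDerivAt (fun s => Real.exp (-ν * s)) (Real.exp (-ν * s) * (-ν)) s := by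
    intro s
    simpa using ((hasDerivAt_id s).const_mul (-ν)).exp
  have hG' : ∀ s, 0 ≤ s → HasDerivWithinAt (fun s => G s x) (ν • G s x) (Ici s) s := by
    intro s hs
    rw [hasDerivWithinAt_iff_tendsto_slope, Ici_sdiff_left]
    have h1 := ((G s).continuous.tendsto _).comp ((hA x (ν • x)).1 hx)
    have h2 : Tendsto (fun r : ℝ => r - s) (𝓝[>] s) (𝓝[>] 0) := by
      refine tendsto_nhdsWithin_iff.2 ⟨?_, ?_⟩
      · refine Tendsto.mono_left ?_ nhdsWithin_le_nhds
        have h5 : Continuous fun r : ℝ => r - s := by fun_prop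
        simpa using h5.tendsto s
      · filter_upwards [self_mem_nhdsWithin] with r hr
        exact sub_pos.2 (mem_Ioi.1 hr)
    have h3 := h1.comp h2
    rw [map_smul] at h3
    refine h3.congr' ?_
    filter_upwards [self_mem_nhdsWithin] with r hr
    have h4 : G r x = G s (G (r - s) x) := by
      rw [← ContinuousLinearMap.comp_apply, ← hG.add s (r - s) hs (sub_pos.2 (mem_Ioi.1 hr)).le,
        add_sub_cancel]
    simp only [Function.comp_apply, map_smul, map_sub, slope_def_module, h4]
  have hconst := constant_of_has_deriv_right_zero (f := y) (a := 0) (b := t)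
    (ContinuousOn.smul (by fun_prop) ((hG.continuousOn x).mono Icc_subset_Ici_self)) (by
      intro s hs
      refine ((hexp s).hasDerivWithinAt.smul (hG' s hs.1)).congr_deriv ?_
      rw [smul_smul, ← add_smul]
      simp) t (right_mem_Icc.2 ht)
  simp only [hy, mul_zero, Real.exp_zero, hG.zero, one_smul, ContinuousLinearMap.id_apply]
    at hconst
  calc G t x = (Real.exp (ν * t) * Real.exp (-ν * t)) • G t x := by
        rw [← Real.exp_add]
        simp
    _ = _ := by rw [mul_smul, hconst]

variable [CompleteSpace H]

/-- Symmetry gives the coordinates of `A₀ u`. For the converse, the coordinate relation makes `u ↦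
⟪A₀ u, x⟫` equal to pairing with `α • x - y`, so `x` lies in the domain of the adjoint, which is the
domain of `A₀`. -/
theorem mem_graph_shiftedNeg_iff {A₀ : H →ₗ.[ℝ] H} (hA₀ : IsSelfAdjoint A₀) {lam : ι → ℝ}
    (he : ∀ j, ∃ hj : e j ∈ A₀.domain, A₀ ⟨e j, hj⟩ = lam j • e j) (α : ℝ) (x y : H) :
    (x, y) ∈ (shiftedNeg A₀ α).graph ↔ ∀ j, ⟪e j, y⟫_ℝ = (α - lam j) * ⟪e j, x⟫_ℝ := by
  have hadj : LinearPMap.adjoint A₀ = A₀ := hA₀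
  have hsym : A₀.IsFormalAdjoint A₀ := by
    have h := LinearPMap.adjoint_isFormalAdjoint hA₀.dense_domain
    rwa [hadj] at h
  have hcoord : ∀ (u : A₀.domain) j, ⟪e j, A₀ u⟫_ℝ = lam j * ⟪e j, (u : H)⟫_ℝ := by
    intro u j
    obtain ⟨hj, hj'⟩ := he j
    have h := hsym ⟨e j, hj⟩ u
    rw [hj', inner_smul_left] at h
    exact h.symm
  rw [LinearPMap.mem_graph_iff]
  constructor
  · intro h j
    obtain ⟨u, rfl, rfl⟩ : ∃ u : A₀.domain, (u : H) = x ∧ -A₀ u + α • (u : H) = y := h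
    rw [inner_add_right, inner_neg_right, inner_smul_right, hcoord]
    ring
  · intro h
    have hmem : x ∈ A₀.domain := by
      rw [← hadj]
      refine LinearPMap.mem_adjoint_domain_of_exists x ⟨α • x - y, fun u => ?_⟩
      rw [← e.tsum_inner_mul_inner, ← e.tsum_inner_mul_inner x]
      refine tsum_congr fun j => ?_
      rw [hcoord, real_inner_comm, inner_sub_right, inner_smul_right, h, real_inner_comm x]
      ring
    refine ⟨⟨x, hmem⟩, rfl, ext_coord e fun j => ?_⟩
    change ⟪e j, -A₀ ⟨x, hmem⟩ + α • x⟫_ℝ = _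
    rw [inner_add_right, inner_neg_right, inner_smul_right, hcoord, h]
    ring

/-- The diagonal semigroup shows that a generated semigroup exists, and the eigenvectors pin down
whichever one the definition chose. -/
theorem generatedSemigroup_coord {A₀ : H →ₗ.[ℝ] H} (hA₀ : IsSelfAdjoint A₀) {lam : ι → ℝ}
    (he : ∀ j, ∃ hj : e j ∈ A₀.domain, A₀ ⟨e j, hj⟩ = lam j • e j) {C : ℝ} (hC : ∀ j, C ≤ lam j)
    (α : ℝ) {t : ℝ} (ht : 0 ≤ t) (j : ι) (x : H) :
    ⟪e j, generatedSemigroup (shiftedNeg A₀ α) t x⟫_ℝ =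
      Real.exp ((α - lam j) * t) * ⟪e j, x⟫_ℝ := by
  have hgr := mem_graph_shiftedNeg_iff hA₀ he α
  have hν : ∀ j, α - lam j ≤ α - C := fun j => by linarith [hC j]
  obtain ⟨G, hG⟩ := exists_diagonalSemigroup e hν
  have hex : ∃ G : ℝ → H →L[ℝ] H, IsC0Semigroup G ∧ IsGenerator G (shiftedNeg A₀ α) :=
    ⟨G, isC0Semigroup_of_diagonal hν hG, isGenerator_of_diagonal hν hG hgr⟩
  rw [generatedSemigroup, dif_pos hex]
  refine coord_of_apply_basis e (m := fun j => Real.exp ((α - lam j) * t)) (fun i => ?_) j x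
  refine hex.choose_spec.1.apply_eigenvector hex.choose_spec.2 ((hgr _ _).2 fun l => ?_) ht
  classical
  rw [inner_smul_right, inner_basis]
  split_ifs with h
  · rw [h]
  · simp

end DiagonalSemigroup

/-! ## The Hamiltonian in coordinates -/

section Hamiltonian

variable {H : Type*} [NormedAddCommGroup H] [InnerProductSpace ℝ H]

@[simp]
theorem pairL_fst {E : Type*} [NormedAddCommGroup E] [InnerProductSpace ℝ E] (f g : E →L[ℝ] H)
    (x : E) : (pairL f g x).fst = f x := rfl

@[simp]
theorem pairL_snd {E : Type*} [NormedAddCommGroup E] [InnerProductSpace ℝ E] (f g : E →L[ℝ] H)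
    (x : E) : (pairL f g x).snd = g x := rfl

@[simp]
theorem fstD_apply (z : Dbl H) : fstD H z = z.fst := rfl

@[simp]
theorem sndD_apply (z : Dbl H) : sndD H z = z.snd := rfl

theorem Dbl.ext {H : Type*} {z w : Dbl H} (h1 : z.fst = w.fst) (h2 : z.snd = w.snd) : z = w :=
  WithLp.ofLp_injective 2 (Prod.ext h1 h2)

open Classical in
theorem spectralProj_coord [CompleteSpace H] (e : HilbertBasis ℕ+ ℝ H) (S : Set ℕ+) (j : ℕ+) (x : H) :
    ⟪e j, spectralProj e S x⟫_ℝ = (if j ∈ S then 1 else 0) * ⟪e j, x⟫_ℝ := by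
  refine coord_of_apply_basis e (m := fun j => if j ∈ S then 1 else 0) (fun i => ?_) j x
  split_ifs with hi
  · rw [one_smul]
    exact Submodule.starProjection_eq_self_iff.2
      (Submodule.le_topologicalClosure _ (Submodule.subset_span ⟨i, hi, rfl⟩))
  · rw [zero_smul]
    refine (Submodule.starProjection_apply_eq_zero_iff _).2 ?_
    rw [Submodule.orthogonal_closure, Submodule.mem_orthogonal]
    intro u hu
    induction hu using Submodule.span_induction with
    | mem u hu =>
      obtain ⟨l, hl, rfl⟩ := hu
      rw [inner_basis, if_neg]
      rintro rfl
      exact hi hl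
    | zero => simp
    | add u w _ _ hu hw => rw [inner_add_left, hu, hw, add_zero]
    | smul r u _ hu => rw [inner_smul_left, hu, mul_zero]

/-- `I` and `C` are complementary projectors, with `I` symmetric. -/
structure IsComplementaryPair (I C : H →L[ℝ] H) : Prop where
  idem_left : ∀ x, I (I x) = I x
  idem_right : ∀ x, C (C x) = C x
  left_right : ∀ x, I (C x) = 0
  right_left : ∀ x, C (I x) = 0
  add : ∀ x, I x + C x = x
  symm_left : ∀ x y, ⟪I x, y⟫_ℝ = ⟪x, I y⟫_ℝ

variable {I C : H →L[ℝ] H}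


theorem IsComplementaryPair.inverse_opF3 (h : IsComplementaryPair I C) {τ : ℝ} (hτ : τ ≠ 0) :
    (opF3 I C 1 τ 1).inverse = opF3 I C 1 τ⁻¹ 1 := by
  refine ContinuousLinearMap.inverse_eq ?_ ?_ <;>
  · refine ContinuousLinearMap.ext fun z => Dbl.ext ?_ ?_
    · simp [opF3, h.idem_left, h.idem_right, h.left_right, h.right_left, smul_smul, hτ, h.add]
    · simp [opF3]

theorem IsComplementaryPair.opB_inverse_opF2 (h : IsComplementaryPair I C) {τ : ℝ} (hτ : τ ≠ 0)
    (a : ℝ) : (opB H).comp ((opF3 I C 1 τ 1).inverse.comp (opF2 I 1 a)) = (-a) • I := by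
  rw [h.inverse_opF3 hτ]
  ext x
  simp [opB, opF3, opF2, h.idem_left, h.right_left]

variable {e : HilbertBasis ℕ+ ℝ H}

open Classical in
theorem isComplementaryPair_of_coord {S : Set ℕ+}
    (hI : ∀ j x, ⟪e j, I x⟫_ℝ = (if j ∈ S then 1 else 0) * ⟪e j, x⟫_ℝ)
    (hC : ∀ j x, ⟪e j, C x⟫_ℝ = (if j ∈ S then 0 else 1) * ⟪e j, x⟫_ℝ) :
    IsComplementaryPair I C where
  idem_left x := ext_coord e fun j => by by_cases hj : j ∈ S <;> simp [hI, hj]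
  idem_right x := ext_coord e fun j => by by_cases hj : j ∈ S <;> simp [hC, hj]
  left_right x := ext_coord e fun j => by by_cases hj : j ∈ S <;> simp [hI, hC, hj]
  right_left x := ext_coord e fun j => by by_cases hj : j ∈ S <;> simp [hI, hC, hj]
  add x := ext_coord e fun j => by by_cases hj : j ∈ S <;> simp [hI, hC, hj, inner_add_right]
  symm_left x y := by
    rw [← e.tsum_inner_mul_inner, ← e.tsum_inner_mul_inner x]
    refine tsum_congr fun j => ?_
    rw [real_inner_comm, hI, hI, real_inner_comm x]
    ring

variable [CompleteSpace H]

theorem adjoint_opB (x : H) : (opB H).adjoint x = pairL (.id ℝ H) (.id ℝ H) x := by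
  refine ext_inner_right ℝ fun z => ?_
  rw [ContinuousLinearMap.adjoint_inner_left]
  simp [opB, WithLp.prod_inner_apply, inner_add_right]

theorem IsComplementaryPair.adjoint_left (h : IsComplementaryPair I C) : I.adjoint = I :=
  ((ContinuousLinearMap.eq_adjoint_iff I I).2 h.symm_left).symm

theorem IsComplementaryPair.adjoint_opF2 (h : IsComplementaryPair I C) (a : ℝ) (z : Dbl H) :
    (opF2 I 1 a).adjoint z = (-a) • I z.fst := by
  refine ext_inner_right ℝ fun x => ?_
  rw [ContinuousLinearMap.adjoint_inner_left]
  simp [opF2, WithLp.prod_inner_apply, inner_smul_left, inner_smul_right, h.symm_left]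

/-- Here `B F₃⁻¹ F₂ = -a I`, which cancels the shift `-a` on the intermediate modes and leaves `-a
C`; and `B F₃⁻¹ B* = (I + τ⁻¹ C) + (I + C)`. -/
theorem IsComplementaryPair.opR_fst (h : IsComplementaryPair I C) {τ : ℝ} (hτ : τ ≠ 0)
    (Λ δ a : ℝ) (z : Dbl H) : (opR I C 1 τ 1 Λ δ a z).fst =
      -(a • C z.fst) + ((2 : ℝ) • I z.snd + (1 + τ⁻¹) • C z.snd) := by
  simp only [opR, h.opB_inverse_opF2 hτ]
  simp only [pairL_fst, ContinuousLinearMap.comp_apply,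
    add_apply, h.inverse_opF3 hτ, adjoint_opB, sndD_apply, fstD_apply]
  simp only [opB, opF3, pairL_fst, pairL_snd, ContinuousLinearMap.comp_apply,
    add_apply, fstD_apply, sndD_apply, sub_apply,
    neg_apply, smul_apply, ContinuousLinearMap.id_apply]
  have h1 := h.add z.fst
  have h2 := h.add z.snd
  nth_rewrite 2 [← h1]
  nth_rewrite 3 [← h2]
  module

/-- The term `F₂* F₃⁻¹ F₂ = a² I` cancels the `a²` in `F₁`, so the coefficient at `v` does not
depend on `a`. -/
theorem IsComplementaryPair.opR_snd (h : IsComplementaryPair I C) {τ : ℝ} (hτ : τ ≠ 0)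
    (Λ δ a : ℝ) (z : Dbl H) : (opR I C 1 τ 1 Λ δ a z).snd =
      -((δ ^ 2 + τ * Λ ^ 2) • I z.fst + Λ ^ 2 • C z.fst) + a • C z.snd := by
  simp only [opR, h.opB_inverse_opF2 hτ]
  simp only [pairL_snd, ContinuousLinearMap.comp_apply,
    add_apply, h.inverse_opF3 hτ, sndD_apply, fstD_apply,
    sub_apply, h.adjoint_opF2, map_smulₛₗ, h.adjoint_left]
  simp only [opF1, opF2, opF3, pairL_fst, ContinuousLinearMap.comp_apply,
    add_apply, fstD_apply, sub_apply,
    smul_apply, ContinuousLinearMap.id_apply, map_smul, h.idem_left, h.right_left]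
  have h2 := h.add z.snd
  nth_rewrite 2 [← h2]
  simp [h.idem_left]
  module

/-- The indices of the intermediate modes. -/
def interModes (lam : ℕ+ → ℝ) (k N : ℕ+) : Set ℕ+ :=
  {j | lam N - ((k : ℕ) : ℝ) ≤ lam j ∧ lam j ≤ lam (N + 1) + ((k : ℕ) : ℝ)}

open Classical in
-- The ordering of the two eigenvalues and `k > 0` make the lower and the higher modes disjoint, so
-- the sum of the two indicators is again an indicator.
theorem outerProj_coord {lam : ℕ+ → ℝ} {k N : ℕ+} (hN : lam N ≤ lam (N + 1)) (j : ℕ+) (x : H) :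
    ⟪e j, outerProj e lam k N x⟫_ℝ = (if j ∈ interModes lam k N then 0 else 1) * ⟪e j, x⟫_ℝ := by
  have hk : (0 : ℝ) < ((k : ℕ) : ℝ) := by exact_mod_cast k.pos
  rw [outerProj, lowerProj, higherProj, add_apply, inner_add_right,
    spectralProj_coord, spectralProj_coord, ← add_mul]
  congr 1
  have hm : j ∈ interModes lam k N ↔
    lam N - ((k : ℕ) : ℝ) ≤ lam j ∧ lam j ≤ lam (N + 1) + ((k : ℕ) : ℝ) := Iff.rfl
  simp only [mem_ofPred_eq]
  split_ifs <;> first | (norm_num; done) | (exfalso; grind)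

open Classical in
theorem interProj_coord {lam : ℕ+ → ℝ} {k N : ℕ+} (hN : lam N ≤ lam (N + 1)) (j : ℕ+) (x : H) :
    ⟪e j, interProj e lam k N x⟫_ℝ = (if j ∈ interModes lam k N then 1 else 0) * ⟪e j, x⟫_ℝ := by
  have h : interProj e lam k N x = x - outerProj e lam k N x := by
    simp [interProj, outerProj, sub_sub]
  rw [h, inner_sub_right, outerProj_coord hN]
  split_ifs <;> ring

/-- The coefficient `β` of the mode `j`, when the scalar function has the value `a`. -/
noncomputable def modeShift (lam : ℕ+ → ℝ) (k N : ℕ+) (a : ℝ) (j : ℕ+) : ℝ :=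
  open Classical in if j ∈ interModes lam k N then 0 else a

/-- The coefficient at `η` in the first equation of the mode `j`. -/
noncomputable def modeFst (lam : ℕ+ → ℝ) (k N : ℕ+) (τ : ℝ) (j : ℕ+) : ℝ :=
  open Classical in if j ∈ interModes lam k N then 2 else 1 + τ⁻¹

/-- The coefficient at `-v` in the second equation of the mode `j`. -/
noncomputable def modeSnd (lam : ℕ+ → ℝ) (k N : ℕ+) (τ Λ δ : ℝ) (j : ℕ+) : ℝ :=
  open Classical in if j ∈ interModes lam k N then δ ^ 2 + τ * Λ ^ 2 else Λ ^ 2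

variable {lam : ℕ+ → ℝ} {k N : ℕ+}

theorem isComplementaryPair_interProj_outerProj (hN : lam N ≤ lam (N + 1)) :
    IsComplementaryPair (interProj e lam k N) (outerProj e lam k N) :=
  isComplementaryPair_of_coord (e := e) (interProj_coord hN) (outerProj_coord hN)

theorem opR_fst_coord (hN : lam N ≤ lam (N + 1)) {τ : ℝ} (hτ : τ ≠ 0) (Λ δ a : ℝ) (z : Dbl H)
    (j : ℕ+) :
    ⟪e j, (opR (interProj e lam k N) (outerProj e lam k N) 1 τ 1 Λ δ a z).fst⟫_ℝ =
      -modeShift lam k N a j * ⟪e j, z.fst⟫_ℝ + modeFst lam k N τ j * ⟪e j, z.snd⟫_ℝ := by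
  rw [(isComplementaryPair_interProj_outerProj hN).opR_fst hτ]
  simp only [inner_add_right, inner_neg_right, inner_smul_right, interProj_coord hN,
    outerProj_coord hN, modeShift, modeFst]
  split_ifs <;> ring

theorem opR_snd_coord (hN : lam N ≤ lam (N + 1)) {τ : ℝ} (hτ : τ ≠ 0) (Λ δ a : ℝ) (z : Dbl H)
    (j : ℕ+) :
    ⟪e j, (opR (interProj e lam k N) (outerProj e lam k N) 1 τ 1 Λ δ a z).snd⟫_ℝ =
      -modeSnd lam k N τ Λ δ j * ⟪e j, z.fst⟫_ℝ + modeShift lam k N a j * ⟪e j, z.snd⟫_ℝ := by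
  rw [(isComplementaryPair_interProj_outerProj hN).opR_snd hτ]
  simp only [inner_add_right, inner_neg_right, inner_smul_right, interProj_coord hN,
    outerProj_coord hN, modeShift, modeSnd]
  split_ifs <;> ring

end Hamiltonian

/-! ## Reduction of diagonal systems to planar systems -/

section ScalarMild

theorem hasDerivAt_of_mild {y f : ℝ → ℝ} {ν : ℝ} (hf : ContinuousOn f (Ici 0))
    (h : ∀ t, 0 ≤ t → y t = Real.exp (ν * t) * (y 0 + ∫ s in (0 : ℝ)..t, Real.exp (-ν * s) * f s))
    {t : ℝ} (ht : 0 < t) : HasDerivAt y (ν * y t + f t) t := by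
  have hc : ContinuousOn (fun s => Real.exp (-ν * s) * f s) (Ici 0) :=
    ContinuousOn.mul (by fun_prop) hf
  have hi : IntervalIntegrable (fun s => Real.exp (-ν * s) * f s) volume 0 t :=
    (hc.mono Icc_subset_Ici_self).intervalIntegrable_of_Icc ht.le
  have hca : ContinuousAt (fun s => Real.exp (-ν * s) * f s) t := hc.continuousAt (Ici_mem_nhds ht)
  have hm : StronglyMeasurableAtFilter (fun s => Real.exp (-ν * s) * f s) (𝓝 t) volume :=
    ContinuousOn.stronglyMeasurableAtFilter isOpen_Ioi (hc.mono Ioi_subset_Ici_self) t ht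
  have h1 : HasDerivAt (fun t => Real.exp (ν * t)) (Real.exp (ν * t) * ν) t := by
    simpa using ((hasDerivAt_id t).const_mul ν).exp
  have h2 := h1.mul ((intervalIntegral.integral_hasDerivAt_right hi hm hca).const_add (y 0))
  refine (h2.congr_of_eventuallyEq ?_).congr_deriv ?_
  · filter_upwards [lt_mem_nhds ht] with s hs
    exact h s hs.le
  · rw [h t ht.le, ← mul_assoc (Real.exp (ν * t)) (Real.exp (-ν * t)), ← Real.exp_add,
      neg_mul, add_neg_cancel, Real.exp_zero]
    ring

theorem integral_exp_mul_eq_of_hasDerivAt {y f : ℝ → ℝ} {ν : ℝ} (hy : ContinuousOn y (Ici 0))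
    (hf : ContinuousOn f (Ici 0)) (h : ∀ t, 0 < t → HasDerivAt y (ν * y t + f t) t) {s t : ℝ}
    (hs : 0 ≤ s) (hst : s ≤ t) :
    ∫ r in s..t, Real.exp (-ν * r) * f r = Real.exp (-ν * t) * y t - Real.exp (-ν * s) * y s := by
  have hsub : Icc s t ⊆ Ici 0 := fun r hr => hs.trans hr.1
  refine intervalIntegral.integral_eq_sub_of_hasDerivAt_of_le hst
    (f := fun r => Real.exp (-ν * r) * y r) (ContinuousOn.mul (by fun_prop) (hy.mono hsub)) ?_ ?_
  · intro r hr
    have h1 : HasDerivAt (fun t => Real.exp (-ν * t)) (Real.exp (-ν * r) * (-ν)) r := by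
      simpa using ((hasDerivAt_id r).const_mul (-ν)).exp
    refine (h1.mul (h r (hs.trans_lt hr.1))).congr_deriv ?_
    ring
  · exact (ContinuousOn.mul (by fun_prop) (hf.mono hsub)).intervalIntegrable_of_Icc hst

end ScalarMild

/-! ### Mild solutions in `H × H` and families of planar solutions -/

section Diagonal

variable {H : Type*} [NormedAddCommGroup H] [InnerProductSpace ℝ H]
  {ι : Type*} {e : HilbertBasis ι ℝ H}

/-- The system `v' = A v + (R z)_1`, `η' = -A η + (R z)_2`, where `A` generates `G`, is diagonal in
the basis `e`, with the modes `v' = (ν - β) v + b η`, `η' = -d v - (ν - β) η`. -/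
structure IsDiagonalSystem (e : HilbertBasis ι ℝ H) (G : ℝ → H →L[ℝ] H)
    (R : ℝ → Dbl H →L[ℝ] Dbl H) (ν : ι → ℝ) (β : ι → ℝ → ℝ) (b d : ι → ℝ) (B : ℝ) : Prop where
  semigroup : ∀ t, 0 ≤ t → ∀ j x, ⟪e j, G t x⟫_ℝ = Real.exp (ν j * t) * ⟪e j, x⟫_ℝ
  fst : ∀ t j z, ⟪e j, (R t z).fst⟫_ℝ = -β j t * ⟪e j, z.fst⟫_ℝ + b j * ⟪e j, z.snd⟫_ℝ
  snd : ∀ t j z, ⟪e j, (R t z).snd⟫_ℝ = -d j * ⟪e j, z.fst⟫_ℝ + β j t * ⟪e j, z.snd⟫_ℝ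
  le : ∀ j, ν j ≤ B
  continuous : ∀ j, Continuous (β j)
  abs_shift_le : ∀ j t, |β j t| ≤ B
  abs_fst_le : ∀ j, |b j| ≤ B
  abs_snd_le : ∀ j, |d j| ≤ B

variable {G : ℝ → H →L[ℝ] H} {R : ℝ → Dbl H →L[ℝ] Dbl H} {ν : ι → ℝ} {β : ι → ℝ → ℝ}
  {b d : ι → ℝ} {B : ℝ}

theorem abs_fst_le_norm (z : Dbl H) (j : ι) : |⟪e j, z.fst⟫_ℝ| ≤ ‖z‖ :=
  (abs_coord_le e _ j).trans (WithLp.norm_fst_le _ z)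

theorem abs_snd_le_norm (z : Dbl H) (j : ι) : |⟪e j, z.snd⟫_ℝ| ≤ ‖z‖ :=
  (abs_coord_le e _ j).trans (WithLp.norm_snd_le _ z)

theorem IsDiagonalSystem.intervalIntegrable (h : IsDiagonalSystem e G R ν β b d B) {f : ℝ → H}
    {M : ι → ℝ} (hM : Summable fun j => M j ^ 2)
    (hf : ∀ j, ContinuousOn (fun t => ⟪e j, f t⟫_ℝ) (Ici 0))
    (hfM : ∀ t, 0 ≤ t → ∀ j, |⟪e j, f t⟫_ℝ| ≤ M j) {s t : ℝ} (hs : 0 ≤ s) (hst : s ≤ t)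
    {p : ℝ → ℝ} (hp : Continuous p) (hp0 : ∀ r ∈ Icc s t, 0 ≤ p r) (hp1 : ∀ r ∈ Icc s t, p r ≤ t) :
    IntervalIntegrable (fun r => G (p r) (f r)) volume s t := by
  have hsub : Icc s t ⊆ Ici 0 := fun r hr => hs.trans hr.1
  refine (continuousOn_of_coord e (M := fun j => Real.exp (|B| * t) * M j) ?_ (fun j => ?_)
    fun r hr j => ?_).intervalIntegrable_of_Icc hst
  · simpa only [mul_pow] using hM.mul_left _
  · have h1 : ContinuousOn (fun r => Real.exp (ν j * p r) * ⟪e j, f r⟫_ℝ) (Icc s t) :=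
      ContinuousOn.mul (by fun_prop) ((hf j).mono hsub)
    exact h1.congr fun r hr => h.semigroup _ (hp0 r hr) j _
  · rw [h.semigroup _ (hp0 r hr), abs_mul, abs_of_pos (Real.exp_pos _)]
    exact mul_le_mul (exp_mul_le_exp_abs_mul (h.le j) (hp0 r hr) (hp1 r hr)) (hfM r (hsub hr) j)
      (abs_nonneg _) (Real.exp_pos _).le

variable [CompleteSpace H]

theorem inner_intervalIntegral {F : ℝ → H} {s t : ℝ} (hF : IntervalIntegrable F volume s t)
    (x : H) : ⟪x, ∫ r in s..t, F r⟫_ℝ = ∫ r in s..t, ⟪x, F r⟫_ℝ := by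
  simpa using ((innerSL ℝ x).intervalIntegral_comp_comm hF).symm

theorem IsDiagonalSystem.isModeSolution (h : IsDiagonalSystem e G R ν β b d B) {z : ℝ → Dbl H}
    (hz : IsSolution G R z) (j : ι) :
    IsModeSolution (fun t => ν j - β j t) (b j) (d j) (fun t => ⟪e j, (z t).fst⟫_ℝ)
      (fun t => ⟪e j, (z t).snd⟫_ℝ) := by
  obtain ⟨hc, hv, hη⟩ := hz
  have hβ := (h.continuous j).continuousOn (s := Ici 0)
  have hvc : ContinuousOn (fun t => ⟪e j, (z t).fst⟫_ℝ) (Ici 0) :=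
    ((innerSL ℝ (e j)).comp (fstD H)).continuous.comp_continuousOn hc
  have hηc : ContinuousOn (fun t => ⟪e j, (z t).snd⟫_ℝ) (Ici 0) :=
    ((innerSL ℝ (e j)).comp (sndD H)).continuous.comp_continuousOn hc
  refine ⟨hvc, hηc, fun t ht => ?_, fun t ht => ?_⟩
  · have h1 := hasDerivAt_of_mild (y := fun t => ⟪e j, (z t).fst⟫_ℝ)
      (f := fun t => ⟪e j, (R t (z t)).fst⟫_ℝ) (ν := ν j) (by
        simp only [h.fst]
        exact (hβ.neg.mul hvc).add (hηc.const_mul _)) (fun t ht => by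
        obtain ⟨hi, he⟩ := hv t ht
        beta_reduce at he
        rw [he, inner_add_right, inner_intervalIntegral hi, h.semigroup t ht, mul_add,
          ← intervalIntegral.integral_const_mul]
        congr 1
        refine intervalIntegral.integral_congr fun s hs => ?_
        rw [uIcc_of_le ht] at hs
        simp only
        rw [h.semigroup _ (sub_nonneg.2 hs.2), ← mul_assoc, ← Real.exp_add]
        ring_nf) ht
    refine h1.congr_deriv ?_
    rw [h.fst]
    ring
  · have h1 := hasDerivAt_of_mild (y := fun t => ⟪e j, (z t).snd⟫_ℝ)
      (f := fun t => ⟪e j, (R t (z t)).snd⟫_ℝ) (ν := -ν j) (by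
        simp only [h.snd]
        exact (hvc.const_mul _).add (hβ.mul hηc)) (fun t ht => by
        -- In one coordinate the backward formula on `[0, t]` can be solved for the value at `t`: it
        -- is the forward formula with rate `-ν j`.
        obtain ⟨hi, he⟩ := hη 0 t le_rfl ht
        beta_reduce at he
        rw [he, inner_sub_right, inner_intervalIntegral hi, sub_zero, h.semigroup t ht]
        have h2 : ∫ s in (0 : ℝ)..t, ⟪e j, G (s - 0) (R s (z s)).snd⟫_ℝ =
            ∫ s in (0 : ℝ)..t, Real.exp (- -ν j * s) * ⟪e j, (R s (z s)).snd⟫_ℝ := by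
          refine intervalIntegral.integral_congr fun s hs => ?_
          rw [uIcc_of_le ht] at hs
          simp only [sub_zero, neg_neg]
          rw [h.semigroup _ hs.1]
        rw [h2, sub_add_cancel, ← mul_assoc, ← Real.exp_add, neg_mul, neg_add_cancel,
          Real.exp_zero, one_mul]) ht
    refine h1.congr_deriv ?_
    rw [h.snd]
    ring

theorem IsDiagonalSystem.isForwardMild (h : IsDiagonalSystem e G R ν β b d B) {x f : ℝ → H}
    {M : ι → ℝ} (hM : Summable fun j => M j ^ 2)
    (hf : ∀ j, ContinuousOn (fun t => ⟪e j, f t⟫_ℝ) (Ici 0))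
    (hfM : ∀ t, 0 ≤ t → ∀ j, |⟪e j, f t⟫_ℝ| ≤ M j)
    (hx : ∀ j, ContinuousOn (fun t => ⟪e j, x t⟫_ℝ) (Ici 0))
    (hd : ∀ j t, 0 < t →
      HasDerivAt (fun t => ⟪e j, x t⟫_ℝ) (ν j * ⟪e j, x t⟫_ℝ + ⟪e j, f t⟫_ℝ) t) :
    IsForwardMild G x f := by
  intro t ht
  have hi := h.intervalIntegrable hM hf hfM le_rfl ht (p := fun s => t - s) (by fun_prop)
    (fun r hr => sub_nonneg.2 hr.2) (fun r hr => by linarith [hr.1])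
  refine ⟨hi, ext_coord e fun j => ?_⟩
  have h1 := integral_exp_mul_eq_of_hasDerivAt (hx j) (hf j) (hd j) le_rfl ht
  have h2 : ∫ s in (0 : ℝ)..t, ⟪e j, G (t - s) (f s)⟫_ℝ =
      Real.exp (ν j * t) * ∫ s in (0 : ℝ)..t, Real.exp (-ν j * s) * ⟪e j, f s⟫_ℝ := by
    rw [← intervalIntegral.integral_const_mul]
    refine intervalIntegral.integral_congr fun s hs => ?_
    rw [uIcc_of_le ht] at hs
    rw [h.semigroup _ (sub_nonneg.2 hs.2), ← mul_assoc, ← Real.exp_add]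
    ring_nf
  rw [inner_add_right, inner_intervalIntegral hi, h.semigroup t ht, h2, h1, mul_zero,
    Real.exp_zero, one_mul, mul_sub, ← mul_assoc, ← Real.exp_add, neg_mul, add_neg_cancel,
    Real.exp_zero]
  ring

theorem IsDiagonalSystem.isBackwardMild (h : IsDiagonalSystem e G R ν β b d B) {y g : ℝ → H}
    {M : ι → ℝ} (hM : Summable fun j => M j ^ 2)
    (hg : ∀ j, ContinuousOn (fun t => ⟪e j, g t⟫_ℝ) (Ici 0))
    (hgM : ∀ t, 0 ≤ t → ∀ j, |⟪e j, g t⟫_ℝ| ≤ M j)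
    (hy : ∀ j, ContinuousOn (fun t => ⟪e j, y t⟫_ℝ) (Ici 0))
    (hd : ∀ j t, 0 < t →
      HasDerivAt (fun t => ⟪e j, y t⟫_ℝ) (-ν j * ⟪e j, y t⟫_ℝ + ⟪e j, g t⟫_ℝ) t) :
    IsBackwardMild G y g := by
  intro t T ht hT
  have hi := h.intervalIntegrable hM hg hgM ht hT (p := fun s => s - t) (by fun_prop)
    (fun r hr => sub_nonneg.2 hr.1) (fun r hr => by linarith [hr.2])
  refine ⟨hi, ext_coord e fun j => ?_⟩
  have h1 := integral_exp_mul_eq_of_hasDerivAt (hy j) (hg j) (hd j) ht hT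
  have h2 : ∫ s in t..T, ⟪e j, G (s - t) (g s)⟫_ℝ =
      Real.exp (-ν j * t) * ∫ s in t..T, Real.exp (- -ν j * s) * ⟪e j, g s⟫_ℝ := by
    rw [← intervalIntegral.integral_const_mul]
    refine intervalIntegral.integral_congr fun s hs => ?_
    rw [uIcc_of_le hT] at hs
    rw [h.semigroup _ (sub_nonneg.2 hs.1), ← mul_assoc, ← Real.exp_add]
    ring_nf
  have h3 : Real.exp (-ν j * t) * Real.exp (- -ν j * T) = Real.exp (ν j * (T - t)) := by
    rw [← Real.exp_add]
    ring_nf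
  have h4 : Real.exp (-ν j * t) * Real.exp (- -ν j * t) = 1 := by
    rw [← Real.exp_add, neg_mul (-ν j), add_neg_cancel, Real.exp_zero]
  rw [inner_sub_right, inner_intervalIntegral hi, h.semigroup _ (sub_nonneg.2 hT), h2, h1]
  linear_combination ⟪e j, y T⟫_ℝ * h3 - ⟪e j, y t⟫_ℝ * h4

/-- One square-summable majorant `M`, uniform in time, does everything: it makes the modes
coordinates of vectors of `H`, and gives continuity, integrability and boundedness. -/
theorem IsDiagonalSystem.exists_isSolution (h : IsDiagonalSystem e G R ν β b d B)
    {v η : ι → ℝ → ℝ} (hvη : ∀ j, IsModeSolution (fun t => ν j - β j t) (b j) (d j) (v j) (η j))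
    {M : ι → ℝ} (hM : Summable fun j => M j ^ 2) (hv : ∀ j t, 0 ≤ t → |v j t| ≤ M j)
    (hη : ∀ j t, 0 ≤ t → |η j t| ≤ M j) :
    ∃ z : ℝ → Dbl H, IsSolution G R z ∧ (∃ K, ∀ t, 0 ≤ t → ‖z t‖ ≤ K) ∧
      ∀ t, 0 ≤ t → ∀ j, ⟪e j, (z t).fst⟫_ℝ = v j t ∧ ⟪e j, (z t).snd⟫_ℝ = η j t := by
  have hsq : ∀ {x : ℝ} {j}, |x| ≤ M j → x ^ 2 ≤ M j ^ 2 := fun hx => by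
    rw [← sq_abs]
    exact pow_le_pow_left₀ (abs_nonneg _) hx 2
  have hM0 : ∀ j, 0 ≤ M j := fun j => (abs_nonneg _).trans (hv j 0 le_rfl)
  have hex : ∀ t : ℝ, ∃ z : Dbl H, 0 ≤ t → ∀ j, ⟪e j, z.fst⟫_ℝ = v j t ∧ ⟪e j, z.snd⟫_ℝ = η j t := by
    intro t
    by_cases ht : 0 ≤ t
    · obtain ⟨x, hx⟩ := exists_coord e
        (hM.of_nonneg_of_le (fun j => sq_nonneg _) fun j => hsq (hv j t ht))
      obtain ⟨y, hy⟩ := exists_coord e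
        (hM.of_nonneg_of_le (fun j => sq_nonneg _) fun j => hsq (hη j t ht))
      exact ⟨WithLp.toLp 2 (x, y), fun _ j => ⟨hx j, hy j⟩⟩
    · exact ⟨0, fun h => absurd h ht⟩
  choose z hz using hex
  have hz1 : ∀ t, 0 ≤ t → ∀ j, ⟪e j, (z t).fst⟫_ℝ = v j t := fun t ht j => (hz t ht j).1
  have hz2 : ∀ t, 0 ≤ t → ∀ j, ⟪e j, (z t).snd⟫_ℝ = η j t := fun t ht j => (hz t ht j).2
  have hf : ∀ t, 0 ≤ t → ∀ j, ⟪e j, (R t (z t)).fst⟫_ℝ = -β j t * v j t + b j * η j t := by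
    intro t ht j
    rw [h.fst, hz1 t ht, hz2 t ht]
  have hg : ∀ t, 0 ≤ t → ∀ j, ⟪e j, (R t (z t)).snd⟫_ℝ = -d j * v j t + β j t * η j t := by
    intro t ht j
    rw [h.snd, hz1 t ht, hz2 t ht]
  have hβ := fun j => (h.continuous j).continuousOn (s := Ici 0)
  have hfc : ∀ j, ContinuousOn (fun t => ⟪e j, (R t (z t)).fst⟫_ℝ) (Ici 0) := fun j =>
    (((hβ j).neg.mul (hvη j).continuousOn_fst).add
      ((hvη j).continuousOn_snd.const_mul (b j))).congr fun t ht => hf t ht j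
  have hgc : ∀ j, ContinuousOn (fun t => ⟪e j, (R t (z t)).snd⟫_ℝ) (Ici 0) := fun j =>
    (((hvη j).continuousOn_fst.const_mul (-d j)).add
      ((hβ j).mul (hvη j).continuousOn_snd)).congr fun t ht => hg t ht j
  -- Each coordinate of `R t (z t)` is a sum of two terms, a coefficient at most `B` times a value
  -- at most `M j`.
  have hM' : Summable fun j => (2 * B * M j) ^ 2 := by
    have h1 : (fun j => (2 * B * M j) ^ 2) = fun j => (2 * B) ^ 2 * M j ^ 2 :=
      funext fun j => mul_pow (2 * B) (M j) 2
    rw [h1]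
    exact hM.mul_left _
  have hbound : ∀ {p q x y : ℝ} {j}, |p| ≤ B → |q| ≤ B → |x| ≤ M j → |y| ≤ M j →
      |p * x + q * y| ≤ 2 * B * M j := by
    intro p q x y j hp hq hx hy
    refine (abs_add_le _ _).trans ?_
    rw [abs_mul, abs_mul]
    have h1 := mul_le_mul hp hx (abs_nonneg _) ((abs_nonneg _).trans hp)
    have h2 := mul_le_mul hq hy (abs_nonneg _) ((abs_nonneg _).trans hq)
    linarith
  have hfM : ∀ t, 0 ≤ t → ∀ j, |⟪e j, (R t (z t)).fst⟫_ℝ| ≤ 2 * B * M j := by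
    intro t ht j
    rw [hf t ht]
    exact hbound (by rw [abs_neg]; exact h.abs_shift_le j t) (h.abs_fst_le j) (hv j t ht) (hη j t ht)
  have hgM : ∀ t, 0 ≤ t → ∀ j, |⟪e j, (R t (z t)).snd⟫_ℝ| ≤ 2 * B * M j := by
    intro t ht j
    rw [hg t ht]
    exact hbound (by rw [abs_neg]; exact h.abs_snd_le j) (h.abs_shift_le j t) (hv j t ht) (hη j t ht)
  refine ⟨z, ⟨?_, ?_, ?_⟩, ?_, hz⟩
  · have h1 : ContinuousOn (fun t => (z t).fst) (Ici 0) :=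
      continuousOn_of_coord e hM (fun j => (hvη j).continuousOn_fst.congr fun t ht => hz1 t ht j)
        fun t ht j => by rw [hz1 t ht]; exact hv j t ht
    have h2 : ContinuousOn (fun t => (z t).snd) (Ici 0) :=
      continuousOn_of_coord e hM (fun j => (hvη j).continuousOn_snd.congr fun t ht => hz2 t ht j)
        fun t ht j => by rw [hz2 t ht]; exact hη j t ht
    exact (WithLp.prodContinuousLinearEquiv 2 ℝ H H).symm.continuous.comp_continuousOn
      (h1.prodMk h2)
  · refine h.isForwardMild hM' hfc hfM (fun j => (hvη j).continuousOn_fst.congr fun t ht => hz1 t ht j)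
      fun j t ht => ?_
    refine (((hvη j).hasDerivAt_fst t ht).congr_of_eventuallyEq ?_).congr_deriv ?_
    · filter_upwards [lt_mem_nhds ht] with s hs
      exact hz1 s hs.le j
    · rw [hf t ht.le, hz1 t ht.le]
      ring
  · refine h.isBackwardMild hM' hgc hgM (fun j => (hvη j).continuousOn_snd.congr fun t ht => hz2 t ht j)
      fun j t ht => ?_
    refine (((hvη j).hasDerivAt_snd t ht).congr_of_eventuallyEq ?_).congr_deriv ?_
    · filter_upwards [lt_mem_nhds ht] with s hs
      exact hz2 s hs.le j
    · rw [hg t ht.le, hz2 t ht.le]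
      ring
  · refine ⟨Real.sqrt (∑' j, M j ^ 2 + ∑' j, M j ^ 2), fun t ht => Real.le_sqrt_of_sq_le ?_⟩
    rw [WithLp.prod_norm_sq_eq_of_L2]
    exact add_le_add
      (hasSum_le (fun j => by rw [hz1 t ht]; exact hsq (hv j t ht)) (hasSum_sq_coord e _) hM.hasSum)
      (hasSum_le (fun j => by rw [hz2 t ht]; exact hsq (hη j t ht)) (hasSum_sq_coord e _) hM.hasSum)

/-- Bounded modes need not sum to a bounded solution. They do when all but finitely many are
controlled by `K₀ * |v 0|`, which is square-summable over `j`; the modes in `S` may keep their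
individual bounds. -/
theorem IsDiagonalSystem.mem_boundedSubspace_iff (h : IsDiagonalSystem e G R ν β b d B)
    (S : Finset ι) {K₀ : ℝ} (hS : ∀ j, j ∉ S → ∀ v η : ℝ → ℝ, ∀ K : ℝ,
      IsModeSolution (fun t => ν j - β j t) (b j) (d j) v η →
      (∀ t, 0 ≤ t → |v t| ≤ K ∧ |η t| ≤ K) →
      ∀ t, 0 ≤ t → |v t| ≤ K₀ * |v 0| ∧ |η t| ≤ K₀ * |v 0|) (z₀ : Dbl H) :
    z₀ ∈ boundedSubspace G R ↔ ∀ j, (⟪e j, z₀.fst⟫_ℝ, ⟪e j, z₀.snd⟫_ℝ) ∈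
      modeSubspace (fun t => ν j - β j t) (b j) (d j) := by
  constructor
  · rintro ⟨z, hz, rfl, K, hK⟩ j
    exact ⟨_, _, h.isModeSolution hz j, rfl, rfl, K, fun t ht =>
      ⟨(abs_fst_le_norm _ j).trans (hK t ht), (abs_snd_le_norm _ j).trans (hK t ht)⟩⟩
  · intro hz₀
    choose v η hvη hv0 hη0 K hK using hz₀
    simp only at hv0 hη0
    classical
    let M : ι → ℝ := fun j => if j ∈ S then K j else K₀ * |v j 0|
    have hM : Summable fun j => M j ^ 2 := by
      have h1 : Summable fun j => if j ∈ S then K j ^ 2 else 0 :=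
        summable_of_ne_finset_zero (s := S) fun j hj => if_neg hj
      have h2 : Summable fun j => K₀ ^ 2 * v j 0 ^ 2 := by
        simp only [hv0]
        exact (hasSum_sq_coord e z₀.fst).summable.mul_left _
      refine (h1.add h2).of_nonneg_of_le (fun j => sq_nonneg _) fun j => ?_
      by_cases hj : j ∈ S
      · simp only [M, if_pos hj]
        have : 0 ≤ K₀ ^ 2 * v j 0 ^ 2 := by positivity
        linarith
      · simp [M, if_neg hj, mul_pow]
    have hb : ∀ j t, 0 ≤ t → |v j t| ≤ M j ∧ |η j t| ≤ M j := by
      intro j t ht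
      by_cases hj : j ∈ S
      · simp only [M, if_pos hj]
        exact hK j t ht
      · simp only [M, if_neg hj]
        exact hS j hj _ _ _ (hvη j) (hK j) t ht
    obtain ⟨z, hz, hzK, hzc⟩ := h.exists_isSolution hvη hM (fun j t ht => (hb j t ht).1)
      (fun j t ht => (hb j t ht).2)
    refine ⟨z, hz, Dbl.ext (ext_coord e fun j => ?_) (ext_coord e fun j => ?_), hzK⟩
    · rw [(hzc 0 le_rfl j).1, hv0]
    · rw [(hzc 0 le_rfl j).2, hη0]

end Diagonal

/-! ## The stable subspaces -/

section Gap

variable {lam : ℕ+ → ℝ} {k N : ℕ+} {Λ δ τ : ℝ}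

theorem one_le_modeFst (hτ : 0 < τ) (j : ℕ+) : 1 ≤ modeFst lam k N τ j := by
  have := inv_pos.2 hτ
  rw [modeFst]
  split_ifs <;> linarith

theorem modeSnd_pos (hτ : 0 < τ) (hΛ : 0 < Λ) (j : ℕ+) : 0 < modeSnd lam k N τ Λ δ j := by
  rw [modeSnd]
  split_ifs <;> positivity

theorem modeFst_le (hτ : 0 < τ) (j : ℕ+) : modeFst lam k N τ j ≤ 2 + τ⁻¹ := by
  have := inv_pos.2 hτ
  rw [modeFst]
  split_ifs <;> linarith

theorem modeSnd_le (hτ : 0 < τ) (j : ℕ+) :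
    modeSnd lam k N τ Λ δ j ≤ δ ^ 2 + τ * Λ ^ 2 + Λ ^ 2 := by
  have h1 : 0 ≤ Λ ^ 2 := sq_nonneg Λ
  have h2 : 0 ≤ δ ^ 2 + τ * Λ ^ 2 := by positivity
  rw [modeSnd]
  split_ifs <;> linarith

theorem abs_modeShift_le {a : ℝ} (ha : |a| ≤ Λ + δ) (j : ℕ+) :
    |modeShift lam k N a j| ≤ Λ + δ := by
  rw [modeShift]
  split_ifs
  · rw [abs_zero]
    exact (abs_nonneg a).trans ha
  · exact ha

theorem continuous_modeShift {X : Type*} [TopologicalSpace X] {a : X → ℝ} (ha : Continuous a)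
    (j : ℕ+) : Continuous fun t => modeShift lam k N (a t) j := by
  by_cases hj : j ∈ interModes lam k N
  · simpa only [modeShift, if_pos hj] using continuous_const
  · simpa only [modeShift, if_neg hj] using ha

/-- The modes above the spectral gap have a uniform dichotomy. -/
theorem exists_mode_gap (hmono : Monotone lam) (hΛ : 0 < Λ) (hδ : 0 < δ)
    (hgap : halfGap lam N / Real.sqrt 5 - δ ≥ 0)
    (hk : ((k : ℕ) : ℝ) ^ 2 - 2 * Λ * ((k : ℕ) : ℝ) - 4 * (Λ ^ 4 / halfGap lam N ^ 2) ≥ 0)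
    {a : ℝ → ℝ} (ha : ∀ t, |a t| ≤ Λ + δ) {j : ℕ+} (hj : N < j) :
    ∃ c : ℝ, 0 < c ∧ modeFst lam k N (1 / 4 * (halfGap lam N / Λ) ^ 2) j *
        modeSnd lam k N (1 / 4 * (halfGap lam N / Λ) ^ 2) Λ δ j < c ^ 2 ∧
      ∀ t, (lam N + lam (N + 1)) / 2 - lam j - modeShift lam k N (a t) j ≤ -c := by
  have hlam : lam (N + 1) ≤ lam j := hmono (PNat.add_one_le_iff.2 hj)
  have hμdef : halfGap lam N = (lam (N + 1) - lam N) / 2 := rfl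
  set μ := halfGap lam N
  have hk0 : (0 : ℝ) < ((k : ℕ) : ℝ) := by exact_mod_cast k.pos
  set κ : ℝ := ((k : ℕ) : ℝ)
  have h5 : 0 < Real.sqrt 5 := Real.sqrt_pos.2 (by norm_num)
  have hδμ : δ * Real.sqrt 5 ≤ μ := by
    rw [ge_iff_le, sub_nonneg, le_div_iff₀ h5] at hgap
    exact hgap
  have hμ : 0 < μ := lt_of_lt_of_le (by positivity) hδμ
  have hsq : 5 * δ ^ 2 ≤ μ ^ 2 := by
    have := pow_le_pow_left₀ (by positivity) hδμ 2
    rwa [mul_pow, Real.sq_sqrt (by norm_num), mul_comm] at this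
  have hlt : δ < μ := lt_of_pow_lt_pow_left₀ 2 hμ.le (by nlinarith [sq_nonneg δ, pow_pos hδ 2])
  have hτΛ : 1 / 4 * (μ / Λ) ^ 2 * Λ ^ 2 = μ ^ 2 / 4 := by field_simp
  by_cases hjI : j ∈ interModes lam k N
  -- Here `b d = 2 (δ² + μ² / 4) ≤ 9 μ² / 10`, because `5 δ² ≤ μ²`, and there is no shift.
  · refine ⟨μ, hμ, ?_, fun t => ?_⟩
    · simp only [modeFst, modeSnd, if_pos hjI, hτΛ]
      nlinarith [pow_pos hμ 2]
    · simp only [modeShift, if_pos hjI]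
      linarith
  · have hgt : lam (N + 1) + κ < lam j := by
      by_contra hcon
      exact hjI ⟨by linarith, not_lt.1 hcon⟩
    have hq : 0 < Λ ^ 4 / μ ^ 2 := by positivity
    -- The quadratic condition on `k` forces `κ > 2 Λ`.
    have hkΛ : 0 < κ - Λ := by
      have : 0 < κ * (κ - 2 * Λ) := by nlinarith
      have := pos_of_mul_pos_right this hk0.le
      linarith
    -- The distance of `λ_j` from `α` is at least `μ + κ` and the shift costs at most `Λ + δ`. The
    -- condition on `k` says `b d ≤ (κ - Λ)²`, and `μ > δ` makes the inequality strict.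
    refine ⟨(κ - Λ) + (μ - δ), by linarith, ?_, fun t => ?_⟩
    · simp only [modeFst, modeSnd, if_neg hjI]
      have h1 : (1 + (1 / 4 * (μ / Λ) ^ 2)⁻¹) * Λ ^ 2 = Λ ^ 2 + 4 * (Λ ^ 4 / μ ^ 2) := by
        field_simp
      rw [h1]
      nlinarith [mul_pos hkΛ (sub_pos.2 hlt), pow_pos (sub_pos.2 hlt) 2]
    · simp only [modeShift, if_neg hjI]
      have := (abs_le.1 (ha t)).1
      linarith

end Gap

/-! ### Closedness and dimension bounds from a map to `ℝ^N` -/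

section CoordinateMaps

variable {H : Type*} [NormedAddCommGroup H] [InnerProductSpace ℝ H]

/-- The first `N` coordinates of a vector. -/
noncomputable def initialCoords (e : HilbertBasis ℕ+ ℝ H) (N : ℕ+) : H →L[ℝ] (Fin N → ℝ) :=
  ContinuousLinearMap.pi fun i => innerSL ℝ (e (Nat.succPNat i))

theorem initialCoords_eq_zero_iff {e : HilbertBasis ℕ+ ℝ H} {N : ℕ+} {x : H} :
    initialCoords e N x = 0 ↔ ∀ j ≤ N, ⟪e j, x⟫_ℝ = 0 := by
  constructor
  · intro h j hj
    -- The index `i` of `Fin N` stands for the mode `i + 1`.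
    have hlt : j.natPred < N := by
      have h2 := PNat.natPred_add_one j
      have h3 : (j : ℕ) ≤ N := hj
      omega
    have h1 := congrFun h ⟨j.natPred, hlt⟩
    simpa [initialCoords] using h1
  · intro h
    ext i
    refine h _ ?_
    rw [← PNat.coe_le_coe]
    exact i.2

/-- A subspace containing the kernel is the preimage of its image, and the image is closed, being
finite-dimensional. -/
theorem isClosed_of_ker_le {E F : Type*} [NormedAddCommGroup E] [NormedSpace ℝ E]
    [NormedAddCommGroup F] [NormedSpace ℝ F] [FiniteDimensional ℝ F] (f : E →L[ℝ] F)
    {W : Submodule ℝ E} (h : f.ker ≤ W) : IsClosed (W : Set E) := by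
  have h1 : W = (W.map f.toLinearMap).comap f.toLinearMap := by
    rw [Submodule.comap_map_eq]
    exact (sup_eq_left.2 h).symm
  rw [h1]
  exact (Submodule.closed_of_finiteDimensional (W.map f.toLinearMap)).preimage f.continuous

theorem rank_quotient_le_of_ker_le {E : Type*} [AddCommGroup E] [Module ℝ E] {n : ℕ}
    (f : E →ₗ[ℝ] (Fin n → ℝ)) {W : Submodule ℝ E} (h : f.ker ≤ W) :
    Module.rank ℝ (E ⧸ W) ≤ (n : Cardinal) := by
  have h1 : Module.rank ℝ (E ⧸ f.ker) ≤ (n : Cardinal) := by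
    have h2 := LinearMap.lift_rank_le_of_injective (f.ker.liftQ f le_rfl)
      (LinearMap.ker_eq_bot.1 (Submodule.ker_liftQ_eq_bot _ _ _ le_rfl))
    simpa using h2
  exact (LinearMap.rank_le_of_surjective (Submodule.factor h)
    (Submodule.factor_surjective h)).trans h1

theorem rank_le_of_disjoint_ker {E : Type*} [AddCommGroup E] [Module ℝ E] {n : ℕ}
    (f : E →ₗ[ℝ] (Fin n → ℝ)) {W : Submodule ℝ E} (h : ∀ x ∈ W, f x = 0 → x = 0) :
    Module.rank ℝ W ≤ (n : Cardinal) := by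
  have h2 := LinearMap.lift_rank_le_of_injective (f.domRestrict W) (by
    rw [← LinearMap.ker_eq_bot, LinearMap.ker_eq_bot']
    exact fun x hx => Subtype.ext (h x x.2 hx))
  simpa using h2

theorem finiteDimensional_of_rank_le {E : Type*} [AddCommGroup E] [Module ℝ E] {n : ℕ}
    (h : Module.rank ℝ E ≤ (n : Cardinal)) : FiniteDimensional ℝ E :=
  Module.rank_lt_aleph0_iff.1 (h.trans_lt Cardinal.natCast_lt_aleph0)

theorem isClosed_vertical : IsClosed (vertical H : Set (Dbl H)) :=
  isClosed_eq (fstD H).continuous continuous_const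

end CoordinateMaps

/-! ### The Fredholm property of diagonal systems with a gap -/

section Stable

variable {H : Type*} [NormedAddCommGroup H] [InnerProductSpace ℝ H] [CompleteSpace H]
  {e : HilbertBasis ℕ+ ℝ H} {G : ℝ → H →L[ℝ] H} {R : ℝ → Dbl H →L[ℝ] Dbl H} {ν : ℕ+ → ℝ}
  {β : ℕ+ → ℝ → ℝ} {b d : ℕ+ → ℝ} {B : ℝ}

/-- If all the modes above `N` of a diagonal system have a uniform dichotomy, then the initial data
of the bounded solutions and the vertical subspace form a Fredholm pair, with explicit bounds. -/
theorem IsDiagonalSystem.isFredholmPair (h : IsDiagonalSystem e G R ν β b d B) {N : ℕ+}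
    (hb : ∀ j, 1 ≤ b j) (hd : ∀ j, 0 < d j)
    (hgap : ∀ j, N < j → ∃ c, 0 < c ∧ b j * d j < c ^ 2 ∧ ∀ t, ν j - β j t ≤ -c) :
    Module.rank ℝ ↥(boundedSubspace G R ⊓ vertical H) ≤ ((N : ℕ) : Cardinal) ∧
    IsClosed ((boundedSubspace G R ⊔ vertical H : Submodule ℝ (Dbl H)) : Set (Dbl H)) ∧
    Module.rank ℝ (Dbl H ⧸ (boundedSubspace G R ⊔ vertical H)) ≤ ((N : ℕ) : Cardinal) ∧
    IsFredholmPair (boundedSubspace G R) (vertical H) := by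
  have hB : 0 < B := (hd 1).trans_le ((le_abs_self _).trans (h.abs_snd_le 1))
  have hb0 : ∀ j, 0 < b j := fun j => zero_lt_one.trans_le (hb j)
  -- The factor does not depend on `j`: `η² ≤ b η² ≤ d v² ≤ B (v 0)²`, using `1 ≤ b` and `d ≤ B`,
  -- and `1 + B` dominates both `1` and `√B`.
  have hstable : ∀ j, N < j → ∀ v η : ℝ → ℝ, ∀ K : ℝ,
      IsModeSolution (fun t => ν j - β j t) (b j) (d j) v η →
      (∀ t, 0 ≤ t → |v t| ≤ K ∧ |η t| ≤ K) →
      ∀ t, 0 ≤ t → |v t| ≤ (1 + B) * |v 0| ∧ |η t| ≤ (1 + B) * |v 0| := by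
    intro j hj v η K hvη hK t ht
    obtain ⟨c, hc, hbd, hω⟩ := hgap j hj
    have hη := fun t ht => (hK t ht).2
    have h1 := hvη.cone (hb0 j) (hd j) hc hbd hω hη ht
    have h2 := hvη.sq_fst_le (hb0 j) (hd j) hc hbd hω hη ht
    have h3 : d j ≤ B := (le_abs_self _).trans (h.abs_snd_le j)
    have hv0 : 0 ≤ v 0 ^ 2 := sq_nonneg _
    have hpos : 0 ≤ (1 + B) * |v 0| := by positivity
    refine ⟨abs_le_of_sq_le_sq ?_ hpos, abs_le_of_sq_le_sq ?_ hpos⟩ <;> rw [mul_pow, sq_abs]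
    · nlinarith [mul_nonneg hB.le hv0, mul_nonneg (sq_nonneg B) hv0]
    · have h4 : η t ^ 2 ≤ b j * η t ^ 2 := le_mul_of_one_le_left (sq_nonneg _) (hb j)
      have h5 : d j * v t ^ 2 ≤ B * v 0 ^ 2 := mul_le_mul h3 h2 (sq_nonneg _) hB.le
      nlinarith [mul_nonneg hB.le hv0, mul_nonneg (sq_nonneg B) hv0]
  have hmem := h.mem_boundedSubspace_iff (Finset.Icc 1 N) (K₀ := 1 + B) (fun j hj =>
    hstable j (not_le.1 fun hjN => hj (Finset.mem_Icc.2 ⟨one_le, hjN⟩)))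
  have hzero : ∀ j, N < j → ∀ y, ((0 : ℝ), y) ∈
      modeSubspace (fun t => ν j - β j t) (b j) (d j) → y = 0 := by
    rintro j hj y ⟨v, η, hvη, hv0, hη0, K, hK⟩
    have h1 := (hstable j hj v η K hvη hK 0 le_rfl).2
    simp only at hv0 hη0
    rwa [hv0, hη0, abs_zero, mul_zero, abs_nonpos_iff] at h1
  -- The stable `η`-coordinate over a given `v`-coordinate; on the first `N` modes only `x = 0` is
  -- served, by the zero solution.
  have hex : ∀ j x, ∃ y, (N < j ∨ x = 0) →
      (x, y) ∈ modeSubspace (fun t => ν j - β j t) (b j) (d j) ∧ |y| ≤ (1 + B) * |x| := by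
    intro j x
    by_cases hx : x = 0
    · refine ⟨0, fun _ => ?_⟩
      rw [hx]
      exact ⟨zero_mem _, by simp⟩
    by_cases hj : N < j
    · obtain ⟨c, hc, hbd, hω⟩ := hgap j hj
      obtain ⟨v, η, hvη, hv0, K, hK⟩ := exists_isModeSolution
        (continuous_const.sub (h.continuous j)) hc hω (hb0 j) (hd j) hbd x
      refine ⟨η 0, fun _ => ⟨⟨v, η, hvη, hv0, rfl, K, hK⟩, ?_⟩⟩
      have h1 := (hstable j hj v η K hvη hK 0 le_rfl).2
      rwa [hv0] at h1
    · exact ⟨0, fun h => absurd h (by tauto)⟩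
  have hinf : Module.rank ℝ ↥(boundedSubspace G R ⊓ vertical H) ≤ ((N : ℕ) : Cardinal) := by
    refine rank_le_of_disjoint_ker ((initialCoords e N).comp (sndD H)).toLinearMap ?_
    rintro z ⟨hz1, hz2⟩ hz3
    have hz2 : z.fst = 0 := hz2
    have hz3 := initialCoords_eq_zero_iff.1 hz3
    refine Dbl.ext hz2 (ext_coord e fun j => ?_)
    change _ = ⟪e j, (0 : H)⟫_ℝ
    rw [inner_zero_right]
    rcases le_or_gt j N with hj | hj
    · exact hz3 j hj
    · refine hzero j hj _ ?_
      have h1 := (hmem z).1 hz1 j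
      rwa [hz2, inner_zero_right] at h1
  -- The vector `w` built from these coordinates lies in `H` by the uniform bound; `(z.fst, w)` is
  -- stable, and the remainder `(0, z.snd - w)` is vertical.
  have hker : ((initialCoords e N).comp (fstD H)).ker ≤ boundedSubspace G R ⊔ vertical H := by
    intro z hz
    have hz := initialCoords_eq_zero_iff.1 hz
    choose y hy using fun j => hex j ⟪e j, z.fst⟫_ℝ
    have hy : ∀ j, (⟪e j, z.fst⟫_ℝ, y j) ∈ modeSubspace (fun t => ν j - β j t) (b j) (d j) ∧
        |y j| ≤ (1 + B) * |⟪e j, z.fst⟫_ℝ| := fun j =>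
      hy j ((lt_or_ge N j).imp id fun hj => hz j hj)
    obtain ⟨w, hw⟩ := exists_coord e (f := y) <| by
      refine ((hasSum_sq_coord e z.fst).summable.mul_left ((1 + B) ^ 2)).of_nonneg_of_le
        (fun j => sq_nonneg _) fun j => ?_
      rw [← mul_pow]
      refine sq_le_sq.2 ((hy j).2.trans_eq ?_)
      rw [abs_mul, abs_of_pos (by linarith : 0 < 1 + B)]
    have h1 : WithLp.toLp 2 (z.fst, w) ∈ boundedSubspace G R := by
      rw [hmem]
      intro j
      change (⟪e j, z.fst⟫_ℝ, ⟪e j, w⟫_ℝ) ∈ _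
      rw [hw]
      exact (hy j).1
    have h2 : WithLp.toLp 2 ((0 : H), z.snd - w) ∈ vertical H := by
      change (0 : H) = 0
      rfl
    have h3 : z = WithLp.toLp 2 (z.fst, w) + WithLp.toLp 2 ((0 : H), z.snd - w) :=
      Dbl.ext (by simp) (by simp)
    rw [h3]
    exact Submodule.add_mem_sup h1 h2
  have hclosed := isClosed_of_ker_le _ hker
  have hquot := rank_quotient_le_of_ker_le _ hker
  refine ⟨hinf, hclosed, hquot, ?_, isClosed_vertical, ?_, hclosed, ?_⟩
  -- By the modewise criterion, the stable subspace is an intersection of preimages of subspaces of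
  -- the plane, which are closed.
  · have h1 : (boundedSubspace G R : Set (Dbl H)) = ⋂ j, (fun z : Dbl H =>
        (⟪e j, z.fst⟫_ℝ, ⟪e j, z.snd⟫_ℝ)) ⁻¹'
        (modeSubspace (fun t => ν j - β j t) (b j) (d j) : Set (ℝ × ℝ)) := by
      ext z
      simp only [mem_iInter]
      exact hmem z
    rw [h1]
    refine isClosed_iInter fun j => (Submodule.closed_of_finiteDimensional _).preimage ?_
    exact ((innerSL ℝ (e j)).comp (fstD H)).continuous.prodMk
      ((innerSL ℝ (e j)).comp (sndD H)).continuous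
  · exact finiteDimensional_of_rank_le hinf
  · exact finiteDimensional_of_rank_le hquot

end Stable

end SpatialAveraging


/-! ### Application to the Hamiltonian system -/

theorem mainTheorem8
    {H : Type*} [NormedAddCommGroup H] [InnerProductSpace ℝ H] [CompleteSpace H]
    {Q : Type*} [MetricSpace Q] [CompleteSpace Q]
    (A₀ : H →ₗ.[ℝ] H) (hA₀ : IsSelfAdjoint A₀)
    (hpos : ∀ x : A₀.domain, x ≠ 0 → 0 < inner ℝ (A₀ x) (x : H))
    (hcpt : SpatialAveraging.HasCompactResolvent A₀)
    (lam : ℕ+ → ℝ) (e : HilbertBasis ℕ+ ℝ H)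
    (he : SpatialAveraging.IsOrderedEigenbasis A₀ lam e)
    (ϑ : Flow ℝ≥0 Q) (a : Q → ℝ) (ha : Continuous a)
    (k N : ℕ+) (Λ δ : ℝ) (hΛ : 0 < Λ) (hδ : 0 < δ)
    (hab : ∀ q : Q, |a q| ≤ Λ + δ)
    (hgap : SpatialAveraging.halfGap lam N / Real.sqrt 5 - δ ≥ 0)
    (hk : ((k : ℕ) : ℝ) ^ 2 - 2 * Λ * ((k : ℕ) : ℝ)
      - 4 * (Λ ^ 4 / SpatialAveraging.halfGap lam N ^ 2) ≥ 0)
    (q : Q) :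
    Module.rank ℝ
        ↥(SpatialAveraging.stableSubspace A₀ lam e ϑ a k N Λ δ q ⊓ SpatialAveraging.vertical H)
      ≤ ((N : ℕ) : Cardinal) ∧
    IsClosed ((SpatialAveraging.stableSubspace A₀ lam e ϑ a k N Λ δ q ⊔
        SpatialAveraging.vertical H : Submodule ℝ (SpatialAveraging.Dbl H)) :
        Set (SpatialAveraging.Dbl H)) ∧
    Module.rank ℝ (SpatialAveraging.Dbl H ⧸
        (SpatialAveraging.stableSubspace A₀ lam e ϑ a k N Λ δ q ⊔ SpatialAveraging.vertical H))
      ≤ ((N : ℕ) : Cardinal) ∧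
    SpatialAveraging.IsFredholmPair
      (SpatialAveraging.stableSubspace A₀ lam e ϑ a k N Λ δ q) (SpatialAveraging.vertical H) := by
  open SpatialAveraging in
  set μ := halfGap lam N with hμdef
  have h5 : 0 < Real.sqrt 5 := Real.sqrt_pos.2 (by norm_num)
  have hμ : 0 < μ := by
    have h1 : 0 < μ / Real.sqrt 5 := by linarith
    exact (div_pos_iff_of_pos_right h5).1 h1
  have hN : lam N ≤ lam (N + 1) := he.monotone (PNat.lt_add_right N 1).le
  set τ : ℝ := 1 / 4 * (μ / Λ) ^ 2 with hτdef
  have hτ : 0 < τ := by positivity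
  have hat : Continuous fun t : ℝ => a (ϑ t.toNNReal q) :=
    ha.comp (ϑ.continuous continuous_real_toNNReal continuous_const)
  set α : ℝ := (lam N + lam (N + 1)) / 2
  have hτi : 0 < τ⁻¹ := inv_pos.2 hτ
  have hD : 0 < δ ^ 2 + τ * Λ ^ 2 + Λ ^ 2 := by positivity
  have hα : α - lam 1 ≤ |α - lam 1| := le_abs_self _
  have hα0 : 0 ≤ |α - lam 1| := abs_nonneg _
  have hlam : ∀ j, lam 1 ≤ lam j := fun j => he.monotone one_le
  have hsys : IsDiagonalSystem e (generatedSemigroup (shiftedNeg A₀ α))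
      (fun t => opR (interProj e lam k N) (outerProj e lam k N) 1 τ 1 Λ δ (a (ϑ t.toNNReal q)))
      (fun j => α - lam j) (fun j t => modeShift lam k N (a (ϑ t.toNNReal q)) j)
      (modeFst lam k N τ) (modeSnd lam k N τ Λ δ)
      -- A sum of bounds for the growth rates, the shift and the two coefficients, so that a single
      -- constant serves for all of them.
      (|α - lam 1| + (Λ + δ) + (2 + τ⁻¹) + (δ ^ 2 + τ * Λ ^ 2 + Λ ^ 2)) :=
    { semigroup := fun t ht j x => generatedSemigroup_coord hA₀ he.eigen hlam α ht j x
      fst := fun t j z => opR_fst_coord hN hτ.ne' Λ δ _ z j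
      snd := fun t j z => opR_snd_coord hN hτ.ne' Λ δ _ z j
      le := fun j => by linarith [hlam j]
      continuous := continuous_modeShift hat
      abs_shift_le := fun j t => (abs_modeShift_le (hab _) j).trans (by linarith)
      abs_fst_le := fun j => by
        rw [abs_of_pos (zero_lt_one.trans_le (one_le_modeFst hτ j))]
        exact (modeFst_le hτ j).trans (by linarith)
      abs_snd_le := fun j => by
        rw [abs_of_pos (modeSnd_pos hτ hΛ j)]
        exact (modeSnd_le hτ j).trans (by linarith) }
  exact hsys.isFredholmPair (one_le_modeFst hτ) (modeSnd_pos hτ hΛ) fun j hj =>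
    exists_mode_gap he.monotone hΛ hδ hgap hk (fun t => hab _) hj
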